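/- Let $\mathcal G$ be a connected undirected weighted graph on the vertex set $\mathcal N=\{1,\dots,N\}$ whose combinatorial Laplacian $L$ is positive semidefinite with $N$ distinct eigenvalues $0=\lambda_1<\lambda_2<\dots<\lambda_N$. Let $L=U\,\mathrm{diag}(\lambda_1,\dots,\lambda_N)\,U^{T}$ with $U$ orthogonal, let $1\le k\le N$, let $U_k$ be the $N\times k$ matrix formed by the first $k$ columns of $U$, and let $\Pi_{bl}=U_kU_k^{T}$. Signal and noise model. The signal $x$ is a random vector in the column space of $U_k$ with mean $0$ and covariance $\Pi_{bl}$; the noise is $n=\sigma\epsilon$ with $\sigma>0$, where $\epsilon$ is independent of $x$ and has mean $0$ and covariance $\Pi_{bl}$ ($k$-bandlimited noise). Let $\mathrm{SNR}=\mathbb E\|x\|_2^2/\mathbb E\|n\|_2^2$. For $\mu>0$ and a nonempty sample set $\mathcal S\subseteq\mathcal N$, graph-Laplacian regularised (GLR) reconstruction from the observation $(x+n)_{\mathcal S}$ of $x+n$ on $\mathcal S$ is $$\hat x_{\mathcal S}=\operatorname*{arg\,min}_{z\in\mathbb R^N}\ \|z_{\mathcal S}-(x+n)_{\mathcal S}\|_2^2+\mu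 z^{T}Lz ,$$ and $\mathrm{MSE}_{\mathcal S}=\mathbb E\|\hat x_{\mathcal S}-x\|_2^2$. A sample set $\mathcal S$ is better than $\mathcal T$ if $\mathrm{MSE}_{\mathcal S}<\mathrm{MSE}_{\mathcal T}$. The bound. Let $\omega(t)=\frac14\bigl(\sqrt t+\frac1{\sqrt t}\bigr)^2$ and, for $1\le m\le N$, $$B_k(m)=\omega\!\left(\frac{\lambda_k}{\lambda_2}\right)\frac Nm+\sum_{i=2}^{m}\omega\!\left(\max\left[1,\frac{\lambda_{k+2-i}}{\lambda_i}\right]\right),$$ where the sum is $0$ for $m=1$ (for $k=1$, where $\lambda_k/\lambda_2$ is $0$ or undefined, the condition below is understood to fail) and the maximum is taken to be $1$ when $k+2-i\le 0$. Let $m_{opt\_bl}\in\{1,\dots,N\}$ be a sample size minimising $B_k$. Theorem. If $B_k(m_{opt\_bl})<k-1$, then $m_{opt\_bl}\le\left\lceil\frac{N+1}{2}\right\rceil$. Moreover, there exists $\mu_{ub\_bl}>0$, and for each $\mu\in(0,\mu_{ub\_bl})$ a threshold $\tau_{GLR\_bl}(\mu)>0$, both depending only on the graph and $k$ (and $\tau_{GLR\_bl}$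 on $\mu$) and not on the distributions of $x$ and $\epsilon$ or on $\sigma$, such that under GLR with parameter $\mu$, if $\mathrm{SNR}<\tau_{GLR\_bl}(\mu)$, then every sample set $\mathcal S\subseteq\mathcal N$ of size $m_{opt\_bl}$ is better than $\mathcal N$. -/

import Mathlib

open MeasureTheory ProbabilityTheory Matrix

namespace GraphSampling

/-- A weighted undirected graph: a simple graph together with symmetric real edge weights, which are
nonzero exactly on the edges.  No sign is imposed on the weights: positive semidefiniteness of the
Laplacian is part of `IsSpectralDecomposition`. -/
structure WeightedGraph (V : Type*) where
  graph : SimpleGraph V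
  weight : V → V → ℝ
  weight_symm : ∀ i j, weight i j = weight j i
  weight_ne_zero_iff : ∀ i j, weight i j ≠ 0 ↔ graph.Adj i j

variable {N : ℕ}

/-- The combinatorial graph Laplacian `D - W`. -/
def WeightedGraph.laplacian (G : WeightedGraph (Fin N)) : Matrix (Fin N) (Fin N) ℝ :=
  Matrix.diagonal (fun i => ∑ j, G.weight i j) - Matrix.of G.weight

/-- The graph frequency `λ_j` with the usual one-based index `j ∈ {1, …, N}`; it is `0` for any
other index. -/
def freq (lam : Fin N → ℝ) (j : ℕ) : ℝ :=
  if h : 1 ≤ j ∧ j ≤ N then lam ⟨j - 1, by omega⟩ else 0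

/-- `L = U Λ Uᵀ` with `Λ = diag(λ_1, …, λ_N)`, `0 = λ_1 < λ_2 < … < λ_N`, and the columns of `U` an
orthonormal basis. -/
structure IsSpectralDecomposition (L : Matrix (Fin N) (Fin N) ℝ) (lam : Fin N → ℝ)
    (U : Matrix (Fin N) (Fin N) ℝ) : Prop where
  strictMono : StrictMono lam
  freq_one : freq lam 1 = 0
  orthogonal : Uᵀ * U = 1
  eq_mul : L = U * Matrix.diagonal lam * Uᵀ

/-- The matrix formed by the first `k` columns of `U`. -/
def firstCols (U : Matrix (Fin N) (Fin N) ℝ) (k : ℕ) :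
    Matrix (Fin N) {l : Fin N // (l : ℕ) < k} ℝ :=
  U.submatrix id Subtype.val

/-- The `k`-bandlimiting projection `Π_bl`. -/
def projBL (U : Matrix (Fin N) (Fin N) ℝ) (k : ℕ) : Matrix (Fin N) (Fin N) ℝ :=
  firstCols U k * (firstCols U k)ᵀ

/-- Squared Euclidean norm. -/
def sqNorm (v : Fin N → ℝ) : ℝ := ∑ i, v i ^ 2

/-- The signal and noise model: `x` is a random `k`-bandlimited signal, centred with covariance
`Π_bl`; `ε` is centred with covariance `Π_bl` (`k`-bandlimited noise); `x` and `ε` are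
independent. -/
structure IsBandlimitedModel {Ω : Type*} [MeasurableSpace Ω] (P : Measure Ω)
    (U : Matrix (Fin N) (Fin N) ℝ) (k : ℕ) (x ε : Ω → Fin N → ℝ) : Prop where
  measurable_signal : Measurable x
  measurable_noise : Measurable ε
  memLp_signal : ∀ i, MemLp (fun ω => x ω i) 2 P
  memLp_noise : ∀ i, MemLp (fun ω => ε ω i) 2 P
  bandlimited : ∀ᵐ ω ∂P, projBL U k *ᵥ x ω = x ω
  mean_signal : ∀ i, ∫ ω, x ω i ∂P = 0
  mean_noise : ∀ i, ∫ ω, ε ω i ∂P = 0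
  cov_signal : ∀ i j, covariance (fun ω => x ω i) (fun ω => x ω j) P = projBL U k i j
  cov_noise : ∀ i j, covariance (fun ω => ε ω i) (fun ω => ε ω j) P = projBL U k i j
  indep : IndepFun x ε P

/-- Signal-to-noise ratio `E‖x‖² / E‖n‖²`. -/
noncomputable def snr {Ω : Type*} [MeasurableSpace Ω] (P : Measure Ω)
    (x n : Ω → Fin N → ℝ) : ℝ :=
  (∫ ω, sqNorm (x ω) ∂P) / (∫ ω, sqNorm (n ω) ∂P)

/-- The objective of graph-Laplacian regularised (GLR) reconstruction from the observations `y` on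
the sample set `S`: `‖z_S - y‖² + μ zᵀ L z`. -/
def glrObjective (L : Matrix (Fin N) (Fin N) ℝ) (μ : ℝ) (S : Finset (Fin N)) (y : S → ℝ)
    (z : Fin N → ℝ) : ℝ :=
  (∑ i : S, (z i - y i) ^ 2) + μ * (z ⬝ᵥ L *ᵥ z)

/-- The GLR reconstruction: the minimiser of the GLR objective.  It exists and is unique for `S`
nonempty and `μ > 0`, see `existsUnique_glr`. -/
noncomputable def glrReconstruction (L : Matrix (Fin N) (Fin N) ℝ) (μ : ℝ) (S : Finset (Fin N))
    (y : S → ℝ) : Fin N → ℝ :=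
  Classical.epsilon fun z => IsMinOn (glrObjective L μ S y) Set.univ z

/-- The mean squared error of GLR reconstruction of the signal `x` when `x + n` is observed on the
sample set `S`. -/
noncomputable def mse {Ω : Type*} [MeasurableSpace Ω] (P : Measure Ω)
    (L : Matrix (Fin N) (Fin N) ℝ) (μ : ℝ) (x n : Ω → Fin N → ℝ) (S : Finset (Fin N)) : ℝ :=
  ∫ ω, sqNorm (glrReconstruction L μ S (fun i : S => (x ω + n ω) i) - x ω) ∂P

/-- `ω(x) = (√x + 1/√x)² / 4`. -/
noncomputable def kantorovich (x : ℝ) : ℝ := (√x + 1 / √x) ^ 2 / 4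

/-- `B_k(m) = r_bl N / m + ∑_{i=2}^m ω(max[1, λ_{k+2-i} / λ_i])` with `r_bl = ω(λ_k / λ_2)`.  For
`i ≥ k + 2` the index `k + 2 - i` truncates to `0`, and `freq lam 0 = 0`, so the maximum is `1`. -/
noncomputable def boundB (lam : Fin N → ℝ) (k m : ℕ) : ℝ :=
  kantorovich (freq lam k / freq lam 2) * (N / m) +
    ∑ i ∈ Finset.Icc 2 m, kantorovich (max 1 (freq lam (k + 2 - i) / freq lam i))

/-- `m` is a sample size (between `1` and `N`) that minimises `B_k`. -/
def IsOptimalSize (lam : Fin N → ℝ) (k m : ℕ) : Prop :=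
  m ∈ Set.Icc 1 N ∧ IsMinOn (boundB lam k) (Set.Icc 1 N) m

theorem laplacian_mulVec_one (G : WeightedGraph (Fin N)) : G.laplacian *ᵥ 1 = 0 := by
  ext i
  simp [WeightedGraph.laplacian, Matrix.sub_mulVec, Matrix.mulVec_diagonal]
  simp [Matrix.mulVec, dotProduct]

theorem IsSpectralDecomposition.quadForm {L : Matrix (Fin N) (Fin N) ℝ} {lam : Fin N → ℝ}
    {U : Matrix (Fin N) (Fin N) ℝ} (h : IsSpectralDecomposition L lam U) (z : Fin N → ℝ) :
    z ⬝ᵥ L *ᵥ z = ∑ l, lam l * (Uᵀ *ᵥ z) l ^ 2 := by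
  rw [h.eq_mul, ← Matrix.mulVec_mulVec, ← Matrix.mulVec_mulVec, Matrix.dotProduct_mulVec,
    ← Matrix.mulVec_transpose]
  simp only [dotProduct, Matrix.mulVec_diagonal]
  exact Finset.sum_congr rfl fun l _ => by ring

theorem IsSpectralDecomposition.pos {L : Matrix (Fin N) (Fin N) ℝ} {lam : Fin N → ℝ}
    {U : Matrix (Fin N) (Fin N) ℝ} (h : IsSpectralDecomposition L lam U) (l : Fin N) :
    0 ≤ lam l ∧ (lam l = 0 → (l : ℕ) = 0) := by
  have hN : 0 < N := l.pos
  have h0 : lam ⟨0, hN⟩ = 0 := by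
    have := h.freq_one
    simpa [freq, Nat.succ_le_iff.2 hN] using this
  refine ⟨h0 ▸ h.strictMono.monotone (Fin.mk_le_of_le_val (Nat.zero_le _)), fun hl => ?_⟩
  have := h.strictMono.injective (hl.trans h0.symm)
  rw [this]

/-- The quadratic part of the GLR objective is positive definite. -/
theorem glr_quad_pos {G : WeightedGraph (Fin N)} {lam : Fin N → ℝ}
    {U : Matrix (Fin N) (Fin N) ℝ} (h : IsSpectralDecomposition G.laplacian lam U)
    {S : Finset (Fin N)} (hS : S.Nonempty) {μ : ℝ} (hμ : 0 < μ) {z : Fin N → ℝ} (hz : z ≠ 0) :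
    0 < (∑ i ∈ S, z i ^ 2) + μ * (z ⬝ᵥ G.laplacian *ᵥ z) := by
  have hUU : U * Uᵀ = 1 := mul_eq_one_comm.1 h.orthogonal
  have hq0 : 0 ≤ z ⬝ᵥ G.laplacian *ᵥ z := by
    rw [h.quadForm]
    exact Finset.sum_nonneg fun l _ => mul_nonneg (h.pos l).1 (sq_nonneg _)
  have hs0 : 0 ≤ ∑ i ∈ S, z i ^ 2 := Finset.sum_nonneg fun i _ => sq_nonneg _
  by_contra hcon
  have hq : z ⬝ᵥ G.laplacian *ᵥ z = 0 := by
    have := mul_nonneg hμ.le hq0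
    have h2 : μ * (z ⬝ᵥ G.laplacian *ᵥ z) = 0 := by linarith
    exact (mul_eq_zero.1 h2).resolve_left hμ.ne'
  have hs : ∑ i ∈ S, z i ^ 2 = 0 := by
    rw [hq] at hcon
    linarith
  obtain ⟨i₀, hi₀⟩ := hS
  have hN : 0 < N := i₀.pos
  have hzS : z i₀ = 0 := by
    have := (Finset.sum_eq_zero_iff_of_nonneg fun i _ => sq_nonneg (z i)).1 hs i₀ hi₀
    simpa using this
  have key : ∀ v : Fin N → ℝ, v ⬝ᵥ G.laplacian *ᵥ v = 0 →
      ∀ i, v i = U i ⟨0, hN⟩ * (Uᵀ *ᵥ v) ⟨0, hN⟩ := by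
    intro v hv i
    rw [h.quadForm, Finset.sum_eq_zero_iff_of_nonneg
      fun l _ => mul_nonneg (h.pos l).1 (sq_nonneg _)] at hv
    have hvi : v i = ∑ l, U i l * (Uᵀ *ᵥ v) l := by
      have : v = U *ᵥ (Uᵀ *ᵥ v) := by rw [Matrix.mulVec_mulVec, hUU, Matrix.one_mulVec]
      exact congrFun this i
    rw [hvi]
    refine Finset.sum_eq_single_of_mem _ (Finset.mem_univ _) fun l _ hl => ?_
    rcases mul_eq_zero.1 (hv l (Finset.mem_univ _)) with h1 | h1
    · exact absurd (Fin.ext ((h.pos l).2 h1)) hl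
    · rw [pow_eq_zero_iff two_ne_zero] at h1
      rw [h1, mul_zero]
  have h1 := key 1 (by rw [laplacian_mulVec_one]; simp) i₀
  have h2 := key z hq i₀
  have hU0 : U i₀ ⟨0, hN⟩ ≠ 0 := by
    intro h0
    rw [h0] at h1
    simp at h1
  rw [hzS] at h2
  have h3 := (mul_eq_zero.1 h2.symm).resolve_left hU0
  exact hz (funext fun i => by rw [key z hq i, h3, mul_zero]; rfl)

/-- Existence and uniqueness of the GLR reconstruction. -/
theorem existsUnique_glr {G : WeightedGraph (Fin N)} {lam : Fin N → ℝ}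
    {U : Matrix (Fin N) (Fin N) ℝ} (h : IsSpectralDecomposition G.laplacian lam U)
    {S : Finset (Fin N)} (hS : S.Nonempty) {μ : ℝ} (hμ : 0 < μ) (y : S → ℝ) :
    ∃! z, IsMinOn (glrObjective G.laplacian μ S y) Set.univ z := by
  classical
  have hbil : ∀ v w : Fin N → ℝ,
      w ⬝ᵥ G.laplacian *ᵥ v = v ⬝ᵥ G.laplacian *ᵥ w := by
    intro v w
    have hLt : G.laplacianᵀ = G.laplacian := by
      rw [h.eq_mul]
      simp [Matrix.transpose_mul, Matrix.mul_assoc]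
    rw [Matrix.dotProduct_mulVec, ← Matrix.mulVec_transpose, hLt, dotProduct_comm]
  -- the normal equations `(Π_S + μ L) z = b`
  let A : (Fin N → ℝ) →ₗ[ℝ] (Fin N → ℝ) :=
    Matrix.toLin' (Matrix.diagonal (fun i => if i ∈ S then (1 : ℝ) else 0) + μ • G.laplacian)
  let b : Fin N → ℝ := fun i => if hi : i ∈ S then y ⟨i, hi⟩ else 0
  have hA : ∀ v w : Fin N → ℝ,
      v ⬝ᵥ A w = (∑ i ∈ S, v i * w i) + μ * (v ⬝ᵥ G.laplacian *ᵥ w) := by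
    intro v w
    simp only [A, Matrix.toLin'_apply, Matrix.add_mulVec, dotProduct_add, Matrix.smul_mulVec,
      dotProduct_smul, smul_eq_mul]
    congr 1
    simp [dotProduct, Matrix.mulVec_diagonal]
  have hpos : ∀ v : Fin N → ℝ, v ≠ 0 → 0 < v ⬝ᵥ A v := by
    intro v hv
    rw [hA]
    simpa [sq] using glr_quad_pos h hS hμ hv
  have hinj : Function.Injective A := by
    rw [injective_iff_map_eq_zero]
    intro v hv
    by_contra hne
    have := hpos v hne
    rw [hv] at this
    simp at this
  obtain ⟨z₀, hz₀⟩ := (LinearMap.injective_iff_surjective.1 hinj) b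
  have hexp : ∀ v : Fin N → ℝ, glrObjective G.laplacian μ S y (z₀ + v) =
      glrObjective G.laplacian μ S y z₀ + v ⬝ᵥ A v := by
    intro v
    have h1 : v ⬝ᵥ A z₀ = ∑ i : S, v i * y i := by
      rw [hz₀, dotProduct, ← Finset.sum_subset (Finset.subset_univ S), ← Finset.sum_coe_sort]
      · exact Finset.sum_congr rfl fun i _ => by simp [b]
      · intro i _ hi
        simp [b, hi]
    rw [hA, ← Finset.sum_coe_sort] at h1
    rw [hA, ← Finset.sum_coe_sort]
    simp only [glrObjective, Matrix.mulVec_add, dotProduct_add, add_dotProduct, hbil v z₀]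
    have h2 : ∑ i : S, ((z₀ + v) i - y i) ^ 2 = ∑ i : S, (z₀ i - y i) ^ 2 +
        2 * ∑ i : S, v i * z₀ i - 2 * ∑ i : S, v i * y i + ∑ i : S, v i * v i := by
      rw [Finset.mul_sum, Finset.mul_sum, ← Finset.sum_add_distrib, ← Finset.sum_sub_distrib,
        ← Finset.sum_add_distrib]
      exact Finset.sum_congr rfl fun i _ => by simp only [Pi.add_apply]; ring
    rw [h2]
    linarith
  refine ⟨z₀, fun z _ => ?_, fun z hz => ?_⟩
  · have := hexp (z - z₀)
    rw [add_sub_cancel] at this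
    change glrObjective G.laplacian μ S y z₀ ≤ glrObjective G.laplacian μ S y z
    rw [this]
    by_cases hv : z - z₀ = 0
    · simp [hv]
    · linarith [hpos _ hv]
  · by_contra hne
    have h1 := hexp (z - z₀)
    rw [add_sub_cancel] at h1
    have h2 := hpos _ (sub_ne_zero.2 hne)
    have h3 : glrObjective G.laplacian μ S y z ≤ glrObjective G.laplacian μ S y z₀ :=
      hz (Set.mem_univ z₀)
    linarith

end GraphSampling

universe u

namespace GraphSampling

/-! GLR reconstruction is linear, so the MSE is a bias term plus `σ ^ 2` times a noise energy
(`mse_eq`), and the SNR is `1 / σ ^ 2`. At low SNR it suffices that every `S` of size `m` has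
strictly smaller noise energy than the full set. The operator extends continuously to `μ = 0`
(`continuousAt_glrMatrix`). There the full set gives the identity, of energy `k`, and `S` gives
harmonic interpolation `P`, of energy at most `1 + B_k(m) < k` (`energy_glrMatrix_zero_le`). The
strict inequality persists for small `μ`, and there are finitely many `S`.

The energy bound (`sum_sq_spectral_le`) uses that `P` is a projection of rank `m`, self-adjoint for
the form of `L`, fixing constants, with `1_S` fixed on the left. In the eigenbasis the zeroth column
contributes `1`. The rest of the zeroth row is the coordinate form of an oblique projection of
`1_S`, and a Kantorovich inequality (`sum_mul_sq_sub_mulVec_le`) bounds it by `ω(λ_k / λ_2) N / m`.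
The remaining block is similar, through the square root of the nonzero spectrum, to an orthogonal
projection `Q` of rank `m - 1`, and `sum_sq_mul_div_le` bounds it by the sum in `B_k`.

For that last bound, put `R = 1 - 2Q`. The squared entries of `R` are doubly stochastic, and few of
them can leave the diagonal because `Q` has small trace. Their corner sums are therefore dominated
by those of the permutation exchanging the outermost indices in pairs, and summation by parts in
both variables makes this permutation extremal. Each exchanged pair contributes one value of `ω`.

The bound on `m` is elementary: it compares `B_k(m)` with `B_k(m - 1)` (`IsOptimalSize.two_mul_le`).
-/

/-! ### Summation by parts and the extremal permutation. -/

theorem sum_mul_le_sum_mul_of_antitone {n : ℕ} {e x y : ℕ → ℝ}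
    (he : ∀ i, i + 1 < n → e (i + 1) ≤ e i) (he0 : ∀ i < n, 0 ≤ e i)
    (h : ∀ s ≤ n, ∑ i ∈ Finset.range s, x i ≤ ∑ i ∈ Finset.range s, y i) :
    ∑ i ∈ Finset.range n, e i * x i ≤ ∑ i ∈ Finset.range n, e i * y i := by
  -- Abel summation as an induction: the weighted gap dominates the last weight times the unweighted
  -- gap, which is nonnegative.
  have key : ∀ s, s + 1 ≤ n →
      e s * (∑ i ∈ Finset.range (s + 1), y i - ∑ i ∈ Finset.range (s + 1), x i) ≤
      ∑ i ∈ Finset.range (s + 1), e i * y i - ∑ i ∈ Finset.range (s + 1), e i * x i := by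
    intro s
    induction s with
    | zero => intro _; simp [mul_sub]
    | succ s ih =>
      intro hs
      have h1 := ih (by omega)
      have h2 := mul_le_mul_of_nonneg_right (he s (by omega)) (sub_nonneg.2 (h (s + 1) (by omega)))
      rw [Finset.sum_range_succ y (s + 1), Finset.sum_range_succ x (s + 1),
        Finset.sum_range_succ (fun i => e i * y i) (s + 1),
        Finset.sum_range_succ (fun i => e i * x i) (s + 1)]
      linarith
  rcases n with _ | n
  · simp
  · have h1 := key n le_rfl
    have h2 := mul_nonneg (he0 n (by omega)) (sub_nonneg.2 (h (n + 1) le_rfl))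
    linarith

theorem sum_mul_le_sum_mul_of_monotone {K : ℕ} {d x y : ℕ → ℝ}
    (hd : ∀ i, i + 1 < K → d i ≤ d (i + 1)) (hd0 : ∀ i < K, 0 ≤ d i)
    (h : ∀ b ≤ K, ∑ i ∈ Finset.Ico b K, x i ≤ ∑ i ∈ Finset.Ico b K, y i) :
    ∑ i ∈ Finset.range K, d i * x i ≤ ∑ i ∈ Finset.range K, d i * y i := by
  rcases K with _ | K
  · simp
  have hr : ∀ (f : ℕ → ℝ) (s : ℕ), s ≤ K + 1 →
      ∑ i ∈ Finset.range s, f (K - i) = ∑ i ∈ Finset.Ico (K + 1 - s) (K + 1), f i := by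
    intro f s hs
    rw [Finset.range_eq_Ico, Finset.sum_Ico_reflect f 0 hs]
    simp
  have := sum_mul_le_sum_mul_of_antitone (n := K + 1) (e := fun i => d (K - i))
    (x := fun i => x (K - i)) (y := fun i => y (K - i))
    (fun i hi => by
      have := hd (K - (i + 1)) (by omega)
      rwa [show K - (i + 1) + 1 = K - i by omega] at this)
    (fun i _ => hd0 _ (by omega))
    (fun s hs => by rw [hr x s hs, hr y s hs]; exact h _ (by omega))
  rw [hr (fun i => d i * x i) _ le_rfl, hr (fun i => d i * y i) _ le_rfl] at this
  simpa only [Nat.sub_self, Nat.Ico_zero_eq_range] using this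

/-- Rearrangement: a bilinear form in an antitone and a monotone sequence is controlled by the
corner sums of its coefficients. -/
theorem sum_sum_mul_le_of_corner_le {n K : ℕ} {e d : ℕ → ℝ} {C Y : ℕ → ℕ → ℝ}
    (he : ∀ i, i + 1 < n → e (i + 1) ≤ e i) (he0 : ∀ i < n, 0 ≤ e i)
    (hd : ∀ i, i + 1 < K → d i ≤ d (i + 1)) (hd0 : ∀ i < K, 0 ≤ d i)
    (h : ∀ s ≤ n, ∀ b ≤ K, ∑ i ∈ Finset.range s, ∑ l ∈ Finset.Ico b K, C i l ≤
      ∑ i ∈ Finset.range s, ∑ l ∈ Finset.Ico b K, Y i l) :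
    ∑ i ∈ Finset.range n, e i * ∑ l ∈ Finset.range K, d l * C i l ≤
      ∑ i ∈ Finset.range n, e i * ∑ l ∈ Finset.range K, d l * Y i l := by
  refine sum_mul_le_sum_mul_of_antitone he he0 fun s hs => ?_
  have hc : ∀ (Z : ℕ → ℕ → ℝ) (A B : Finset ℕ) (g : ℕ → ℝ),
      ∑ i ∈ A, ∑ l ∈ B, g l * Z i l = ∑ l ∈ B, g l * ∑ i ∈ A, Z i l := by
    intro Z A B g
    rw [Finset.sum_comm]
    simp only [Finset.mul_sum]
  rw [hc, hc]
  refine sum_mul_le_sum_mul_of_monotone hd hd0 fun b hb => ?_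
  rw [Finset.sum_comm, Finset.sum_comm (s := Finset.Ico b K)]
  exact h s hs b hb

/-- The involution of `ℕ` that exchanges `j` and `K - 1 - j` for `j < r`. -/
def outerSwap (r K i : ℕ) : ℕ :=
  if i < K ∧ (i < r ∨ K - 1 - i < r) then K - 1 - i else i

/-- The minimum on the left is the upper bound that `corner_reflection_le` finds for a reflection.
The permutation reaches it in every corner at once, hence its extremality. -/
theorem le_card_outerSwap (r K s b : ℕ) (hb : b ≤ K) :
    min s (min (K - b) (r + (s - b))) ≤
      ((Finset.range s).filter fun i => outerSwap r K i ∈ Finset.Ico b K).card := by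
  -- Once `r` exceeds `K / 2` the swap is the full reversal. The three intervals below are the low
  -- indices sent up, the fixed middle, and the high indices sent down.
  set ρ := min r (K / 2) with hρ
  have hsub : Finset.Ico 0 (min s (min ρ (K - b))) ∪ (Finset.Ico (max ρ b) (min s (K - ρ)) ∪
      Finset.Ico (K - ρ) (min s (K - b))) ⊆
      (Finset.range s).filter fun i => outerSwap r K i ∈ Finset.Ico b K := by
    intro i hi
    simp only [Finset.mem_union, Finset.mem_Ico, Finset.mem_filter, Finset.mem_range,
      outerSwap] at hi ⊢
    split_ifs <;> omega
  refine le_trans ?_ (Finset.card_le_card hsub)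
  rw [Finset.card_union_of_disjoint, Finset.card_union_of_disjoint]
  · simp only [Nat.card_Ico]
    omega
  · rw [Finset.disjoint_left]
    intro i
    simp only [Finset.mem_Ico]
    omega
  · rw [Finset.disjoint_left]
    intro i
    simp only [Finset.mem_union, Finset.mem_Ico]
    omega

/-! ### Entries of a reflection `1 - 2Q`. -/

section Projection

variable {ι : Type*} {Q : Matrix ι ι ℝ}

theorem sum_sq_row_of_isSymm_of_idem [Fintype ι] (hs : Q.IsSymm) (hi : Q * Q = Q) (i : ι) :
    ∑ j, Q i j ^ 2 = Q i i := by
  conv_rhs => rw [← hi, Matrix.mul_apply]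
  exact Finset.sum_congr rfl fun j _ => by rw [hs.apply i j, sq]

variable [DecidableEq ι]

theorem isSymm_reflection (hs : Q.IsSymm) : (1 - (2 : ℝ) • Q).IsSymm := by
  simp [Matrix.IsSymm, hs.eq]

theorem reflection_sq_apply (i j : ι) :
    (1 - (2 : ℝ) • Q) i j ^ 2 = (if i = j then 1 - 4 * Q i i else 0) + 4 * Q i j ^ 2 := by
  by_cases h : i = j
  · subst h; simp; ring
  · simp [h]; ring

theorem sum_sum_reflection_sq_comm (hs : Q.IsSymm) (I B : Finset ι) :
    ∑ i ∈ I, ∑ l ∈ B, (1 - (2 : ℝ) • Q) i l ^ 2 =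
      ∑ l ∈ B, ∑ i ∈ I, (1 - (2 : ℝ) • Q) l i ^ 2 := by
  rw [Finset.sum_comm]
  exact Finset.sum_congr rfl fun l _ => Finset.sum_congr rfl fun i _ => by
    rw [(isSymm_reflection hs).apply l i]

variable [Fintype ι]

theorem sum_sq_row_reflection (hs : Q.IsSymm) (hi : Q * Q = Q) (i : ι) :
    ∑ j, (1 - (2 : ℝ) • Q) i j ^ 2 = 1 := by
  simp only [reflection_sq_apply, Finset.sum_add_distrib, ← Finset.mul_sum,
    sum_sq_row_of_isSymm_of_idem hs hi]
  simp

/-- The compression `X = Q 1_B Q` satisfies `tr X - tr X² ≤ tr Q / 4`, since `(X - Q / 2)²` has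
nonnegative trace. The left side of this is exactly the squared norm of the off-diagonal block of
`Q`. -/
theorem sum_sum_compl_sq_le (hs : Q.IsSymm) (hi : Q * Q = Q) (B : Finset ι) :
    4 * ∑ l ∈ B, ∑ i ∈ Bᶜ, Q l i ^ 2 ≤ Q.trace := by
  set X : Matrix ι ι ℝ := Q * Matrix.diagonal (fun i => if i ∈ B then (1 : ℝ) else 0) * Q with hX
  set Pd : Matrix ι ι ℝ := Matrix.diagonal (fun i => if i ∈ B then (1 : ℝ) else 0) with hPd
  have hXs : X.IsSymm := by
    simp only [Matrix.IsSymm, hX, Matrix.transpose_mul, hPd, Matrix.diagonal_transpose, hs.eq,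
      Matrix.mul_assoc]
  have hXQ : X * Q = X := by rw [hX, Matrix.mul_assoc, hi]
  have hQX : Q * X = X := by rw [hX, ← Matrix.mul_assoc, ← Matrix.mul_assoc, hi]
  have h0 : 0 ≤ ((X - (1 / 2 : ℝ) • Q) * (X - (1 / 2 : ℝ) • Q)).trace := by
    have : (X - (1 / 2 : ℝ) • Q) * (X - (1 / 2 : ℝ) • Q) =
        (X - (1 / 2 : ℝ) • Q)ᵀ * (X - (1 / 2 : ℝ) • Q) := by
      rw [Matrix.transpose_sub, Matrix.transpose_smul, hXs.eq, hs.eq]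
    rw [this, Matrix.trace]
    refine Finset.sum_nonneg fun i _ => ?_
    rw [Matrix.diag_apply, Matrix.mul_apply]
    exact Finset.sum_nonneg fun j _ => by rw [Matrix.transpose_apply]; exact mul_self_nonneg _
  have h1 : (X - (1 / 2 : ℝ) • Q) * (X - (1 / 2 : ℝ) • Q) = X * X - X + (1 / 4 : ℝ) • Q := by
    rw [Matrix.sub_mul, Matrix.mul_sub, Matrix.mul_sub, Matrix.mul_smul, Matrix.smul_mul,
      Matrix.smul_mul, Matrix.mul_smul, hXQ, hQX, hi]
    module
  rw [h1, Matrix.trace_add, Matrix.trace_sub, Matrix.trace_smul, smul_eq_mul] at h0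
  have h2 : X.trace = ∑ l ∈ B, Q l l := by
    rw [hX, Matrix.mul_assoc, Matrix.trace_mul_comm, Matrix.mul_assoc, hi, Matrix.trace]
    simp [hPd, Matrix.diagonal_mul]
  have h3 : (X * X).trace = ∑ l ∈ B, ∑ i ∈ B, Q l i ^ 2 := by
    have : (X * X).trace = (Pd * Q * (Pd * Q)).trace := by
      have : X * X = Q * (Pd * Q * Pd * Q) := by
        simp only [hX, Matrix.mul_assoc]
        rw [← Matrix.mul_assoc Q Q, hi]
      rw [this, Matrix.trace_mul_comm]
      simp only [Matrix.mul_assoc, hi]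
    have hPQ : ∀ i j, (Pd * Q) i j = if i ∈ B then Q i j else 0 := by
      intro i j
      simp [hPd, Matrix.diagonal_mul]
    rw [this]
    change ∑ l, ∑ i, (Pd * Q) l i * (Pd * Q) i l = _
    simp only [hPQ]
    rw [← Finset.sum_subset (Finset.subset_univ B)]
    · refine Finset.sum_congr rfl fun l hl => ?_
      rw [← Finset.sum_subset (Finset.subset_univ B)]
      · exact Finset.sum_congr rfl fun i hi => by simp [hl, hi, hs.apply l i, sq]
      · intro i _ hi; simp [hi]
    · intro l _ hl; simp [hl]
  have h4 : ∑ l ∈ B, ∑ i ∈ Bᶜ, Q l i ^ 2 = ∑ l ∈ B, Q l l - ∑ l ∈ B, ∑ i ∈ B, Q l i ^ 2 := by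
    rw [← Finset.sum_sub_distrib]
    refine Finset.sum_congr rfl fun l _ => ?_
    rw [← sum_sq_row_of_isSymm_of_idem hs hi l, ← Finset.sum_add_sum_compl B]
    ring
  linarith

theorem sum_sum_reflection_sq_le_card (hs : Q.IsSymm) (hi : Q * Q = Q) (I B : Finset ι) :
    ∑ i ∈ I, ∑ l ∈ B, (1 - (2 : ℝ) • Q) i l ^ 2 ≤ I.card := by
  calc _ ≤ ∑ i ∈ I, (1 : ℝ) := Finset.sum_le_sum fun i _ => by
        rw [← sum_sq_row_reflection hs hi i]
        exact Finset.sum_le_sum_of_subset_of_nonneg (Finset.subset_univ _)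
          fun _ _ _ => sq_nonneg _
    _ = I.card := by simp

/-- Columns in `I ∩ B` cost at most `1` each. The columns of `B \ I` meet `I` only off the diagonal,
where entries of the reflection are `-2` times those of `Q`, so the trace bounds their share. -/
theorem sum_sum_reflection_sq_le_trace (hs : Q.IsSymm) (hi : Q * Q = Q) (I B : Finset ι) :
    ∑ i ∈ I, ∑ l ∈ B, (1 - (2 : ℝ) • Q) i l ^ 2 ≤ Q.trace + (I ∩ B).card := by
  rw [sum_sum_reflection_sq_comm hs, ← Finset.sum_inter_add_sum_sdiff B I, add_comm]
  refine add_le_add ?_ ?_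
  · refine le_trans ?_ (sum_sum_compl_sq_le hs hi (B \ I))
    rw [Finset.mul_sum]
    refine Finset.sum_le_sum fun l hl => ?_
    rw [Finset.mul_sum]
    have hsub : I ⊆ (B \ I)ᶜ := fun i hi => by simp [hi]
    refine le_trans (Finset.sum_le_sum fun i hi => ?_)
      (Finset.sum_le_sum_of_subset_of_nonneg hsub fun _ _ _ => by positivity)
    rw [reflection_sq_apply, if_neg, zero_add]
    rintro rfl
    exact (Finset.mem_sdiff.1 hl).2 hi
  · rw [Finset.inter_comm]
    exact sum_sum_reflection_sq_le_card hs hi _ _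

end Projection

/-! ### The function `ω`, and passage between `Fin n` and natural indices. -/

theorem kantorovich_eq {x : ℝ} (hx : 0 < x) : kantorovich x = (x + 1 / x + 2) / 4 := by
  have h := Real.sqrt_pos.2 hx
  have h2 := Real.sq_sqrt hx.le
  rw [kantorovich]
  congr 1
  have : (√x + 1 / √x) ^ 2 = √x ^ 2 + 1 / √x ^ 2 + 2 := by field_simp; ring
  rw [this, h2]

theorem one_le_kantorovich {x : ℝ} (hx : 0 < x) : 1 ≤ kantorovich x := by
  rw [kantorovich_eq hx]
  have : x + 1 / x - 2 = (x - 1) ^ 2 / x := by field_simp; ring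
  have h2 : 0 ≤ (x - 1) ^ 2 / x := by positivity
  linarith

theorem kantorovich_one : kantorovich 1 = 1 := by
  rw [kantorovich_eq one_pos]; norm_num

/-- Extension by zero of a matrix to a function of natural indices. -/
def natExtend {n : ℕ} (C : Matrix (Fin n) (Fin n) ℝ) (i l : ℕ) : ℝ :=
  if h : i < n ∧ l < n then C ⟨i, h.1⟩ ⟨l, h.2⟩ else 0

theorem natExtend_coe {n : ℕ} (C : Matrix (Fin n) (Fin n) ℝ) (i l : Fin n) :
    natExtend C i l = C i l := by
  simp [natExtend]

theorem sum_eq_sum_fin_filter {n : ℕ} {A : Finset ℕ} (hA : ∀ i ∈ A, i < n) (f : ℕ → ℝ) :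
    ∑ i ∈ A, f i = ∑ i ∈ Finset.univ.filter (fun i : Fin n => (i : ℕ) ∈ A), f i := by
  symm
  refine Finset.sum_bij (fun i _ => (i : ℕ)) (fun i hi => (Finset.mem_filter.1 hi).2)
    (fun i _ j _ h => Fin.ext h) (fun i hi => ⟨⟨i, hA i hi⟩, by simpa using hi, rfl⟩)
    fun _ _ => rfl

theorem card_fin_filter {n : ℕ} {A : Finset ℕ} (hA : ∀ i ∈ A, i < n) :
    (Finset.univ.filter fun i : Fin n => (i : ℕ) ∈ A).card = A.card := by
  have := sum_eq_sum_fin_filter hA fun _ => 1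
  simp only [Finset.sum_const, nsmul_eq_mul, mul_one] at this
  exact_mod_cast this.symm

theorem sum_sum_natExtend {n : ℕ} (C : Matrix (Fin n) (Fin n) ℝ) {A B : Finset ℕ}
    (hA : ∀ i ∈ A, i < n) (hB : ∀ i ∈ B, i < n) :
    ∑ i ∈ A, ∑ l ∈ B, natExtend C i l =
      ∑ i ∈ Finset.univ.filter (fun i : Fin n => (i : ℕ) ∈ A),
        ∑ l ∈ Finset.univ.filter (fun l : Fin n => (l : ℕ) ∈ B), C i l := by
  rw [sum_eq_sum_fin_filter hA]
  refine Finset.sum_congr rfl fun i _ => ?_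
  rw [sum_eq_sum_fin_filter hB]
  exact Finset.sum_congr rfl fun l _ => natExtend_coe C i l

/-! ### Truncated Khatri–Rao and Kantorovich inequalities. -/

section Projection

variable {n : ℕ} {Q : Matrix (Fin n) (Fin n) ℝ}

theorem corner_reflection_le (hs : Q.IsSymm) (hi : Q * Q = Q) {r : ℕ} (htr : Q.trace = r)
    {K s b : ℕ} (hK : K ≤ n) (hsn : s ≤ n) (hb : b ≤ K) :
    ∑ i ∈ Finset.range s, ∑ l ∈ Finset.Ico b K,
        natExtend (Matrix.of fun i l => (1 - (2 : ℝ) • Q) i l ^ 2) i l ≤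
      ∑ i ∈ Finset.range s, ∑ l ∈ Finset.Ico b K, if l = outerSwap r K i then (1 : ℝ) else 0 := by
  have hA : ∀ i ∈ Finset.range s, i < n := fun i hi => by simp at hi; omega
  have hB : ∀ i ∈ Finset.Ico b K, i < n := fun i hi => by simp at hi; omega
  have hR : ∑ i ∈ Finset.range s, ∑ l ∈ Finset.Ico b K,
      (if l = outerSwap r K i then (1 : ℝ) else 0) =
      ((Finset.range s).filter fun i => outerSwap r K i ∈ Finset.Ico b K).card := by
    rw [Finset.card_filter]
    push_cast
    exact Finset.sum_congr rfl fun i _ => by rw [Finset.sum_ite_eq']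
  rw [hR, sum_sum_natExtend _ hA hB]
  simp only [Matrix.of_apply]
  set I := Finset.univ.filter fun i : Fin n => (i : ℕ) ∈ Finset.range s with hI
  set J := Finset.univ.filter fun i : Fin n => (i : ℕ) ∈ Finset.Ico b K with hJ
  have h1 := sum_sum_reflection_sq_le_card hs hi I J
  have h2 := sum_sum_reflection_sq_le_card hs hi J I
  rw [← sum_sum_reflection_sq_comm hs] at h2
  have h3 := sum_sum_reflection_sq_le_trace hs hi I J
  have h4 : (I ∩ J).card ≤ s - b := by
    have : I ∩ J ⊆ Finset.univ.filter fun i : Fin n => (i : ℕ) ∈ Finset.Ico b s := by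
      intro i
      simp only [hI, hJ, Finset.mem_inter, Finset.mem_filter, Finset.mem_range, Finset.mem_Ico,
        Finset.mem_univ, true_and]
      omega
    refine (Finset.card_le_card this).trans ?_
    rw [card_fin_filter (fun i hi => by simp at hi; omega), Nat.card_Ico]
  rw [hI, card_fin_filter hA, Finset.card_range] at h1
  rw [hJ, card_fin_filter hB, Nat.card_Ico] at h2
  rw [htr] at h3
  refine le_trans ?_ (Nat.cast_le.2 (le_card_outerSwap r K s b hb))
  push_cast
  refine le_min h1 (le_min ?_ ?_)
  · exact_mod_cast h2
  · refine h3.trans ?_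
    have : ((I ∩ J).card : ℝ) ≤ ((s - b : ℕ) : ℝ) := Nat.cast_le.2 h4
    gcongr

/-- An exchanged pair with ratio `t` contributes `t + 1/t`, which exceeds the value `2` of a fixed
pair by `4 (ω(t) - 1)`. -/
theorem sum_outerSwap_div_le {a : ℕ → ℝ} {K : ℕ} (ha : ∀ i < K, 0 < a i) (r : ℕ) :
    ∑ j ∈ Finset.range K, a (outerSwap r K j) / a j ≤
      K + 4 * ∑ j ∈ Finset.range r,
        ((if 2 * j + 1 < K then kantorovich (a (K - 1 - j) / a j) else 1) - 1) := by
  set g : ℕ → ℝ := fun j => a (outerSwap r K j) / a j - 1 with hg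
  set w : ℕ → ℝ := fun j => (if 2 * j + 1 < K then kantorovich (a (K - 1 - j) / a j) else 1) - 1
    with hw
  have hgw : ∀ j < K, 2 * j + 1 < K → g j + g (K - 1 - j) = if j < r then 4 * w j else 0 := by
    intro j hj hj2
    have h1 := ha j hj
    have h2 := ha (K - 1 - j) (by omega)
    have h3 : K - 1 - (K - 1 - j) = j := by omega
    by_cases hr : j < r
    · have e1 : outerSwap r K j = K - 1 - j := if_pos ⟨hj, Or.inl hr⟩
      have e2 : outerSwap r K (K - 1 - j) = j := by
        rw [outerSwap, if_pos ⟨by omega, Or.inr (by omega)⟩, h3]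
      simp only [hg, hw, e1, e2, if_pos hr, if_pos hj2, kantorovich_eq (div_pos h2 h1)]
      field_simp
      ring
    · have e1 : outerSwap r K j = j := if_neg (by omega)
      have e2 : outerSwap r K (K - 1 - j) = K - 1 - j := if_neg (by omega)
      simp [hg, e1, e2, hr, h1.ne', h2.ne']
  -- Each `j` below the midpoint is grouped with its mirror image. A midpoint `2 * j + 1 = K` is
  -- fixed and has `g j = 0`.
  have hfold : ∑ j ∈ Finset.range K, g j =
      ∑ j ∈ Finset.range K, if 2 * j + 1 < K then g j + g (K - 1 - j) else 0 := by
    have h1 : ∑ j ∈ Finset.range K, (if 2 * j + 1 < K then g (K - 1 - j) else 0) =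
        ∑ j ∈ Finset.range K, if K < 2 * j + 1 then g j else 0 := by
      rw [← Finset.sum_range_reflect]
      refine Finset.sum_congr rfl fun j hj => ?_
      rw [Finset.mem_range] at hj
      rw [show K - 1 - (K - 1 - j) = j by omega]
      exact if_congr (by omega) rfl rfl
    have h2 : ∀ j, (if 2 * j + 1 < K then g j + g (K - 1 - j) else 0) =
        (if 2 * j + 1 < K then g j else 0) + if 2 * j + 1 < K then g (K - 1 - j) else 0 := by
      intro j; split_ifs <;> simp
    simp only [h2]
    rw [Finset.sum_add_distrib, h1, ← Finset.sum_add_distrib]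
    refine Finset.sum_congr rfl fun j hj => ?_
    rw [Finset.mem_range] at hj
    rcases lt_trichotomy (2 * j + 1) K with h | h | h
    · rw [if_pos h, if_neg (by omega), add_zero]
    · have : outerSwap r K j = j := by rw [outerSwap]; split_ifs <;> omega
      simp [hg, this, (ha j hj).ne']
    · rw [if_neg (by omega), if_pos h, zero_add]
  have hw0 : ∀ j, 0 ≤ w j := by
    intro j
    simp only [hw]
    split_ifs with h
    · exact sub_nonneg.2 (one_le_kantorovich (div_pos (ha _ (by omega)) (ha _ (by omega))))
    · simp
  have hle : ∑ j ∈ Finset.range K, (if 2 * j + 1 < K then g j + g (K - 1 - j) else 0) ≤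
      ∑ j ∈ Finset.range r, 4 * w j := by
    have h1 : ∀ j ∈ Finset.range K, (if 2 * j + 1 < K then g j + g (K - 1 - j) else 0) ≤
        if j < r then 4 * w j else 0 := by
      intro j hj
      have := hw0 j
      by_cases h : 2 * j + 1 < K
      · rw [if_pos h, hgw j (Finset.mem_range.1 hj) h]
      · rw [if_neg h]; split_ifs <;> linarith
    refine (Finset.sum_le_sum h1).trans ?_
    rw [← Finset.sum_filter]
    refine Finset.sum_le_sum_of_subset_of_nonneg (fun j hj => ?_) fun j _ _ => ?_
    · simpa using (Finset.mem_filter.1 hj).2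
    · linarith [hw0 j]
  have hsum : ∑ j ∈ Finset.range K, g j = ∑ j ∈ Finset.range K, a (outerSwap r K j) / a j - K := by
    simp [hg, Finset.sum_sub_distrib]
  rw [← Finset.mul_sum] at hle
  linarith

/-- A truncated Khatri–Rao inequality: `tr (Q Λ⁻¹ Q Λ_K)` for an orthogonal projection `Q` of
rank `r`, where `Λ = diag a` and `Λ_K` keeps the first `K` entries of `Λ`. -/
theorem sum_sq_mul_div_le (hs : Q.IsSymm) (hi : Q * Q = Q) {r : ℕ} (htr : Q.trace = r)
    {a : ℕ → ℝ} (ha : ∀ i < n, 0 < a i) (hmono : ∀ i, i + 1 < n → a i ≤ a (i + 1))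
    {K : ℕ} (hK : K ≤ n) :
    ∑ i : Fin n, ∑ l : Fin n, (if (l : ℕ) < K then Q i l ^ 2 * (a l / a i) else 0) ≤
      ∑ j ∈ Finset.range r, if 2 * j + 1 < K then kantorovich (a (K - 1 - j) / a j) else 1 := by
  have hab := sum_sum_mul_le_of_corner_le (n := n) (K := K) (e := fun i => 1 / a i) (d := a)
    (C := natExtend (Matrix.of fun i l => (1 - (2 : ℝ) • Q) i l ^ 2))
    (Y := fun i l => if l = outerSwap r K i then (1 : ℝ) else 0)
    (fun i h => one_div_le_one_div_of_le (ha i (by omega)) (hmono i h))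
    (fun i h => (one_div_pos.2 (ha i h)).le)
    (fun i h => hmono i (by omega)) (fun i h => (ha i (by omega)).le)
    (fun s hsn b hb => corner_reflection_le hs hi htr hK hsn hb)
  have hRHS : ∑ i ∈ Finset.range n, 1 / a i * ∑ l ∈ Finset.range K,
      a l * (if l = outerSwap r K i then (1 : ℝ) else 0) =
      ∑ i ∈ Finset.range K, a (outerSwap r K i) / a i := by
    symm
    rw [← Finset.sum_subset (Finset.range_mono hK)]
    · refine Finset.sum_congr rfl fun i hi => ?_
      have h1 : outerSwap r K i ∈ Finset.range K := by
        simp only [Finset.mem_range, outerSwap] at hi ⊢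
        split_ifs <;> omega
      simp only [mul_ite, mul_one, mul_zero, Finset.sum_ite_eq', if_pos h1]
      ring
    · intro i _ hi
      have h1 : outerSwap r K i ∉ Finset.range K := by
        simp only [Finset.mem_range, outerSwap] at hi ⊢
        split_ifs <;> omega
      simp only [mul_ite, mul_one, mul_zero, Finset.sum_ite_eq', if_neg h1]
  have hLHS : ∑ i ∈ Finset.range n, 1 / a i * ∑ l ∈ Finset.range K,
      a l * natExtend (Matrix.of fun i l => (1 - (2 : ℝ) • Q) i l ^ 2) i l =
      ∑ i : Fin n, (if (i : ℕ) < K then 1 - 4 * Q i i else 0) + 4 *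
      ∑ i : Fin n, ∑ l : Fin n, (if (l : ℕ) < K then Q i l ^ 2 * (a l / a i) else 0) := by
    rw [← Fin.sum_univ_eq_sum_range (fun i => 1 / a i * ∑ l ∈ Finset.range K,
      a l * natExtend (Matrix.of fun i l => (1 - (2 : ℝ) • Q) i l ^ 2) i l) n,
      Finset.mul_sum, ← Finset.sum_add_distrib]
    refine Finset.sum_congr rfl fun i _ => ?_
    rw [sum_eq_sum_fin_filter (n := n) (fun l hl => by simp at hl; omega), Finset.sum_filter,
      Finset.mul_sum, Finset.mul_sum]
    simp only [natExtend_coe, Matrix.of_apply, reflection_sq_apply, Finset.mem_range]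
    have h1 : (if (i : ℕ) < K then 1 - 4 * Q i i else 0) =
        ∑ l : Fin n, if i = l then (if (l : ℕ) < K then 1 - 4 * Q i i else 0) else 0 := by
      simp
    rw [h1, ← Finset.sum_add_distrib]
    refine Finset.sum_congr rfl fun l _ => ?_
    have hai := (ha i i.2).ne'
    by_cases hl : (l : ℕ) < K
    · by_cases hil : i = l
      · subst hil
        simp only [hl, if_true]
        field_simp
      · simp only [hl, hil, if_true, if_false]
        field_simp
        ring
    · simp [hl]
  -- The `-4 * r` lost on the diagonal cancels the `-1` in each of the `r` summands of
  -- `sum_outerSwap_div_le`, leaving `ω` itself.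
  have hdiag : ∑ i : Fin n, (if (i : ℕ) < K then 1 - 4 * Q i i else 0) ≥ K - 4 * r := by
    have hq : ∀ i, 0 ≤ Q i i := fun i => by
      rw [← sum_sq_row_of_isSymm_of_idem hs hi i]
      exact Finset.sum_nonneg fun _ _ => sq_nonneg _
    have h1 : ∑ i : Fin n, (if (i : ℕ) < K then (1 : ℝ) else 0) = K := by
      rw [← Finset.sum_filter]
      have := card_fin_filter (n := n) (A := Finset.range K) (fun l hl => by simp at hl; omega)
      simp only [Finset.mem_range, Finset.card_range] at this
      simp [this]
    rw [ge_iff_le, ← htr, ← h1, Matrix.trace, Finset.mul_sum, ← Finset.sum_sub_distrib]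
    refine Finset.sum_le_sum fun i _ => ?_
    have := hq i
    simp only [Matrix.diag_apply]
    split_ifs <;> linarith
  have hsw := sum_outerSwap_div_le (K := K) (fun i h => ha i (by omega)) r
  rw [Finset.sum_sub_distrib] at hsw
  simp only [Finset.sum_const, Finset.card_range, nsmul_eq_mul, mul_one] at hsw
  rw [hLHS, hRHS] at hab
  linarith

/-- A truncated Kantorovich inequality for the oblique projection `Λ^{1/2} (1 - Q) Λ^{-1/2}`. -/
theorem sum_mul_sq_sub_mulVec_le (hs : Q.IsSymm) (hi : Q * Q = Q)
    {a : ℕ → ℝ} (ha : ∀ i < n, 0 < a i) (hmono : ∀ i j, i ≤ j → j < n → a i ≤ a j)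
    {K : ℕ} (hK0 : 0 < K) (hK : K ≤ n) (y : Fin n → ℝ) :
    ∑ l : Fin n, (if (l : ℕ) < K then a l * (y l - (Q *ᵥ y) l) ^ 2 else 0) ≤
      kantorovich (a (K - 1) / a 0) * ∑ l : Fin n, a l * y l ^ 2 := by
  set z : Fin n → ℝ := y - Q *ᵥ y with hz
  set W := ∑ l : Fin n, a l * y l ^ 2 with hW
  set X := ∑ l : Fin n, z l ^ 2 / a l with hX
  set T := ∑ l : Fin n, z l ^ 2 with hT
  have hp := ha 0 (by omega)
  have hq := ha (K - 1) (by omega)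
  have hW0 : 0 ≤ W := Finset.sum_nonneg fun l _ => mul_nonneg (ha l l.2).le (sq_nonneg _)
  have hQz : Q *ᵥ z = 0 := by rw [hz, Matrix.mulVec_sub, Matrix.mulVec_mulVec, hi, sub_self]
  -- `z` lies in the kernel of the symmetric `Q`, so it is orthogonal to `Q *ᵥ y`.
  have hzy : ∑ l, z l * y l = T := by
    have h1 : z ⬝ᵥ (Q *ᵥ y) = 0 := by
      rw [Matrix.dotProduct_mulVec, ← Matrix.mulVec_transpose, hs.eq, hQz, zero_dotProduct]
    have h2 : z ⬝ᵥ y = z ⬝ᵥ z + z ⬝ᵥ (Q *ᵥ y) := by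
      rw [← dotProduct_add, hz, sub_add_cancel]
    rw [h1, add_zero] at h2
    simpa [dotProduct, hT, sq] using h2
  have hCS : T ^ 2 ≤ X * W := by
    rw [← hzy]
    refine Finset.sum_sq_le_sum_mul_sum_of_sq_le_mul _ (fun l _ => ?_) (fun l _ => ?_)
      (fun l _ => ?_)
    · exact div_nonneg (sq_nonneg _) (ha l l.2).le
    · exact mul_nonneg (ha l l.2).le (sq_nonneg _)
    · have := (ha l l.2).ne'
      rw [show z l ^ 2 / a l * (a l * y l ^ 2) = (z l * y l) ^ 2 by field_simp]
  have hD : ∑ l : Fin n, (if (l : ℕ) < K then a l * z l ^ 2 else 0) ≤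
      (a 0 + a (K - 1)) * T - a 0 * a (K - 1) * X := by
    rw [hT, hX, Finset.mul_sum, Finset.mul_sum, ← Finset.sum_sub_distrib]
    refine Finset.sum_le_sum fun l _ => ?_
    have hl := ha l l.2
    have h0 := hmono 0 l (Nat.zero_le _) l.2
    -- With `p = a 0` and `q = a (K - 1)`: below `K` this is `(a l - p) * (q - a l) ≥ 0` divided by
    -- `a l`. From `K` on it only needs `p ≤ a l`, which makes the right side nonnegative; this is
    -- why truncation does no harm.
    have hc : (if (l : ℕ) < K then a l else 0) ≤
        (a 0 + a (K - 1)) - a 0 * a (K - 1) / a l := by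
      split_ifs with h
      · have h1 := hmono l (K - 1) (by omega) (by omega)
        have : (a 0 + a (K - 1)) - a 0 * a (K - 1) / a l - a l =
            (a l - a 0) * (a (K - 1) - a l) / a l := by field_simp; ring
        have h2 : 0 ≤ (a l - a 0) * (a (K - 1) - a l) / a l :=
          div_nonneg (mul_nonneg (by linarith) (by linarith)) hl.le
        linarith
      · have : a 0 * a (K - 1) / a l ≤ a (K - 1) := by
          rw [div_le_iff₀ hl]
          nlinarith
        linarith
    have := mul_le_mul_of_nonneg_right hc (sq_nonneg (z l))
    have h3 : (a 0 + a (K - 1)) * z l ^ 2 - a 0 * a (K - 1) * (z l ^ 2 / a l) =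
        ((a 0 + a (K - 1)) - a 0 * a (K - 1) / a l) * z l ^ 2 := by ring
    rw [h3]
    refine le_trans (le_of_eq ?_) this
    split_ifs <;> simp
  refine le_trans (le_of_eq ?_) (hD.trans ?_)
  · rfl
  rcases hW0.eq_or_lt with h | h
  · have hT0 : T = 0 := by
      rw [← h, mul_zero] at hCS
      exact pow_eq_zero_iff two_ne_zero |>.1 (le_antisymm hCS (sq_nonneg _))
    have hX0 : 0 ≤ X := Finset.sum_nonneg fun l _ => div_nonneg (sq_nonneg _) (ha l l.2).le
    rw [hT0, ← h]
    have := mul_nonneg (mul_nonneg hp.le hq.le) hX0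
    linarith
  · have hX1 : T ^ 2 / W ≤ X := by rwa [div_le_iff₀ h]
    have h1 := mul_le_mul_of_nonneg_left hX1 (mul_nonneg hp.le hq.le)
    -- `(p + q) T - p q T² / W` is a concave quadratic in `T` with maximum `(p + q)² W / (4 p q)`;
    -- the difference is the completed square.
    have h2 : kantorovich (a (K - 1) / a 0) * W -
        ((a 0 + a (K - 1)) * T - a 0 * a (K - 1) * (T ^ 2 / W)) =
        ((a 0 + a (K - 1)) * W - 2 * (a 0 * a (K - 1)) * T) ^ 2 / (4 * (a 0 * a (K - 1)) * W) := by
      rw [kantorovich_eq (div_pos hq hp)]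
      field_simp
      ring
    have h3 : 0 ≤ ((a 0 + a (K - 1)) * W - 2 * (a 0 * a (K - 1)) * T) ^ 2 /
        (4 * (a 0 * a (K - 1)) * W) := by positivity
    linarith

end Projection

/-! ### The energy bound in spectral coordinates. -/

theorem freq_add_two {n : ℕ} (lam : Fin (n + 1) → ℝ) (i : Fin n) :
    freq lam (i + 2) = lam i.succ := by
  rw [freq, dif_pos ⟨by omega, by omega⟩]
  rfl

theorem sum_range_le_sum_Icc_kantorovich {N : ℕ} {lam : Fin N → ℝ} (K m : ℕ)
    (ha : ∀ i, i + 1 < N → 0 < freq lam (i + 2))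
    (hmono : ∀ i j, i ≤ j → j + 1 < N → freq lam (i + 2) ≤ freq lam (j + 2)) (hK : K + 1 ≤ N) :
    ∑ j ∈ Finset.range (m - 1), (if 2 * j + 1 < K then
        kantorovich (freq lam (K - 1 - j + 2) / freq lam (j + 2)) else 1) ≤
      ∑ i ∈ Finset.Icc 2 m,
        kantorovich (max 1 (freq lam (K + 1 + 2 - i) / freq lam i)) := by
  rw [← Finset.Ico_add_one_right_eq_Icc, Finset.sum_Ico_eq_sum_range,
    show m + 1 - 2 = m - 1 by omega]
  refine Finset.sum_le_sum fun j hj => ?_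
  rw [Finset.mem_range] at hj
  split_ifs with h
  · have h1 : K + 1 + 2 - (2 + j) = K - 1 - j + 2 := by omega
    rw [h1, add_comm 2 j, max_eq_right]
    rw [one_le_div (ha j (by omega))]
    exact hmono _ _ (by omega) (by omega)
  · exact one_le_kantorovich (lt_max_of_lt_left one_pos)

/-- The energy bound in spectral coordinates: `A` is an oblique projection of rank `m`, self-adjoint
for the form `diag lam`, which fixes the kernel of that form. -/
theorem sum_sq_spectral_le {n : ℕ} {lam : Fin (n + 1) → ℝ} (hlam : StrictMono lam)
    (h0 : lam 0 = 0) {A : Matrix (Fin (n + 1)) (Fin (n + 1)) ℝ}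
    (hsymm : ∀ i j, lam i * A i j = lam j * A j i) (hidem : A * A = A)
    (hcol : ∀ i, A i 0 = if i = 0 then 1 else 0) {m : ℕ} (hm : 1 ≤ m)
    (htr : A.trace = m) {v : Fin (n + 1) → ℝ} (hv : v ᵥ* A = v)
    (hv0 : v 0 ^ 2 = (m : ℝ) ^ 2 / (n + 1)) (hvv : ∑ i, v i ^ 2 = m)
    {K : ℕ} (hK0 : 0 < K) (hK : K ≤ n) :
    ∑ i, ∑ j : Fin (n + 1), (if (j : ℕ) < K + 1 then A i j ^ 2 else 0) ≤
      1 + boundB lam (K + 1) m := by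
  -- The zero eigenvalue is dropped: `a 0` is `λ_2` and, with `k = K + 1`, `a (K - 1)` is `λ_k`.
  set a : ℕ → ℝ := fun i => freq lam (i + 2) with ha_def
  have haf : ∀ i : Fin n, a i = lam i.succ := freq_add_two lam
  have ha : ∀ i < n, 0 < a i := fun i hi => by
    rw [haf ⟨i, hi⟩, ← h0]
    exact hlam (Fin.succ_pos _)
  have hmono : ∀ i j, i ≤ j → j < n → a i ≤ a j := fun i j hij hj => by
    rw [haf ⟨i, by omega⟩, haf ⟨j, hj⟩]
    exact hlam.monotone (Fin.succ_le_succ_iff.2 hij)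
  -- Conjugation by the square root of the nonzero spectrum turns self-adjointness for `diag lam`
  -- into symmetry. The zeroth column of `A` vanishes below its top entry, so this block stays
  -- idempotent and loses one unit of trace.
  set Q : Matrix (Fin n) (Fin n) ℝ :=
    Matrix.of fun i j => √(a i) * A i.succ j.succ / √(a j) with hQ
  have hsq : ∀ i : Fin n, √(a i) ^ 2 = a i := fun i => Real.sq_sqrt (ha i i.2).le
  have hsq0 : ∀ i : Fin n, √(a i) ≠ 0 := fun i => (Real.sqrt_pos.2 (ha i i.2)).ne'
  have hQs : Q.IsSymm := by
    ext i j
    rw [Matrix.transpose_apply]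
    simp only [hQ, Matrix.of_apply]
    rw [div_eq_div_iff (hsq0 i) (hsq0 j)]
    have := hsymm i.succ j.succ
    rw [← haf, ← haf] at this
    linear_combination -this + A j.succ i.succ * hsq j - A i.succ j.succ * hsq i
  have hmul : ∀ i j : Fin n, ∑ l : Fin n, A i.succ l.succ * A l.succ j.succ = A i.succ j.succ := by
    intro i j
    have := congrFun (congrFun hidem i.succ) j.succ
    rw [Matrix.mul_apply, Fin.sum_univ_succ, hcol, if_neg (Fin.succ_ne_zero i), zero_mul,
      zero_add] at this
    exact this
  have hQi : Q * Q = Q := by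
    ext i j
    rw [Matrix.mul_apply]
    simp only [hQ, Matrix.of_apply]
    rw [← hmul i j, Finset.mul_sum, Finset.sum_div]
    refine Finset.sum_congr rfl fun l _ => ?_
    have := hsq0 l
    field_simp
  have hQt : Q.trace = ((m - 1 : ℕ) : ℝ) := by
    have : A.trace = 1 + Q.trace := by
      rw [Matrix.trace, Fin.sum_univ_succ, Matrix.diag_apply, hcol, if_pos rfl, Matrix.trace]
      congr 1
      refine Finset.sum_congr rfl fun i _ => ?_
      have := hsq0 i
      simp only [hQ, Matrix.diag_apply, Matrix.of_apply]
      field_simp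
    rw [htr] at this
    push_cast [hm]
    linarith
  have hblock := sum_sq_mul_div_le hQs hQi hQt ha (fun i hi => hmono i (i + 1) (by omega) hi) hK
  have hblock' : ∑ i : Fin n, ∑ l : Fin n, (if (l : ℕ) < K then Q i l ^ 2 * (a l / a i) else 0) =
      ∑ i : Fin n, ∑ l : Fin n, (if (l : ℕ) < K then A i.succ l.succ ^ 2 else 0) := by
    refine Finset.sum_congr rfl fun i _ => Finset.sum_congr rfl fun l _ => ?_
    refine if_congr Iff.rfl ?_ rfl
    have h1 := (ha i i.2).ne'
    have h2 := (ha l l.2).ne'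
    simp only [hQ, Matrix.of_apply, div_pow, mul_pow, hsq]
    field_simp
  set y : Fin n → ℝ := fun i => v i.succ / √(a i) with hy
  have hrow := sum_mul_sq_sub_mulVec_le hQs hQi ha hmono hK0 hK y
  have hyy : ∑ l : Fin n, a l * y l ^ 2 = m - v 0 ^ 2 := by
    rw [← hvv, Fin.sum_univ_succ, add_sub_cancel_left]
    refine Finset.sum_congr rfl fun l _ => ?_
    have := (ha l l.2).ne'
    simp only [hy, div_pow, hsq]
    field_simp
  -- Reading `v ᵥ* A = v` in column `l.succ` isolates `v 0 * A 0 l.succ`; the other terms are `√(a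
  -- l)` times `Q *ᵥ y`.
  have hvrow : ∀ l : Fin n, a l * (y l - (Q *ᵥ y) l) ^ 2 = v 0 ^ 2 * A 0 l.succ ^ 2 := by
    intro l
    have h1 : √(a l) * (Q *ᵥ y) l = ∑ i : Fin n, v i.succ * A i.succ l.succ := by
      rw [← hQs.eq, Matrix.mulVec, dotProduct, Finset.mul_sum]
      refine Finset.sum_congr rfl fun i _ => ?_
      have h1 := hsq0 i
      have h2 := hsq0 l
      simp only [hQ, hy, Matrix.transpose_apply, Matrix.of_apply]
      field_simp
    have h2 : √(a l) * y l = v l.succ := by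
      have h2 := hsq0 l
      simp only [hy]
      field_simp
    have h3 : v 0 * A 0 l.succ + ∑ i : Fin n, v i.succ * A i.succ l.succ = v l.succ := by
      have := congrFun hv l.succ
      rwa [Matrix.vecMul, dotProduct, Fin.sum_univ_succ] at this
    rw [← hsq l, ← mul_pow, ← mul_pow, mul_sub, h1, h2, ← h3, add_sub_cancel_right]
  have hm0 : (0 : ℝ) < m := by exact_mod_cast hm
  have hn0 : (0 : ℝ) < n + 1 := by positivity
  have hv0p : 0 < v 0 ^ 2 := by rw [hv0]; positivity
  have hκ := one_le_kantorovich (div_pos (ha (K - 1) (by omega)) (ha 0 (by omega)))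
  have hrow' : ∑ l : Fin n, (if (l : ℕ) < K then A 0 l.succ ^ 2 else 0) ≤
      kantorovich (a (K - 1) / a 0) * ((n + 1) / m) := by
    have h1 : ∑ l : Fin n, (if (l : ℕ) < K then a l * (y l - (Q *ᵥ y) l) ^ 2 else 0) =
        v 0 ^ 2 * ∑ l : Fin n, (if (l : ℕ) < K then A 0 l.succ ^ 2 else 0) := by
      rw [Finset.mul_sum]
      refine Finset.sum_congr rfl fun l _ => ?_
      rw [hvrow, mul_ite, mul_zero]
    rw [h1, hyy] at hrow
    refine le_of_mul_le_mul_left (hrow.trans ?_) hv0p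
    have h2 : v 0 ^ 2 * (kantorovich (a (K - 1) / a 0) * ((n + 1) / m)) =
        kantorovich (a (K - 1) / a 0) * m := by
      rw [hv0]; field_simp
    rw [h2]
    exact mul_le_mul_of_nonneg_left (by linarith) (by linarith)
  have hsplit : ∑ i, ∑ j : Fin (n + 1), (if (j : ℕ) < K + 1 then A i j ^ 2 else 0) =
      1 + (∑ l : Fin n, (if (l : ℕ) < K then A 0 l.succ ^ 2 else 0) +
        ∑ i : Fin n, ∑ l : Fin n, (if (l : ℕ) < K then A i.succ l.succ ^ 2 else 0)) := by
    rw [Fin.sum_univ_succ]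
    simp only [Fin.sum_univ_succ (n := n), hcol, Fin.val_succ, Fin.val_zero, add_lt_add_iff_right,
      Fin.succ_ne_zero]
    simp
    ring
  rw [hsplit]
  rw [hblock'] at hblock
  have hsum := sum_range_le_sum_Icc_kantorovich (lam := lam) K m
    (fun i hi => ha i (by omega)) (fun i j hij hj => hmono i j hij (by omega)) (by omega)
  have hB : boundB lam (K + 1) m = kantorovich (a (K - 1) / a 0) * ((n + 1) / m) +
      ∑ i ∈ Finset.Icc 2 m, kantorovich (max 1 (freq lam (K + 1 + 2 - i) / freq lam i)) := by
    rw [boundB]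
    simp only [ha_def, show K - 1 + 2 = K + 1 by omega]
    push_cast
    rfl
  rw [hB]
  have := hblock.trans hsum
  linarith

/-! ### The GLR operator and its harmonic limit at `μ = 0`. -/

variable {N : ℕ}

/-- The coordinate projection onto a sample set. -/
def samplingProj (S : Finset (Fin N)) : Matrix (Fin N) (Fin N) ℝ :=
  Matrix.diagonal fun i => if i ∈ S then 1 else 0

theorem samplingProj_mulVec (S : Finset (Fin N)) (z : Fin N → ℝ) (i : Fin N) :
    (samplingProj S *ᵥ z) i = if i ∈ S then z i else 0 := by
  simp [samplingProj, Matrix.mulVec_diagonal]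

theorem samplingProj_mul_self (S : Finset (Fin N)) :
    samplingProj S * samplingProj S = samplingProj S := by
  simp [samplingProj]

theorem samplingProj_transpose (S : Finset (Fin N)) : (samplingProj S)ᵀ = samplingProj S := by
  simp [samplingProj]

theorem samplingProj_trace (S : Finset (Fin N)) : (samplingProj S).trace = S.card := by
  simp [samplingProj, Matrix.trace]

/-- The normal equations of GLR reconstruction, with the rows outside the sample set divided
by `μ`, so that they make sense for `μ = 0`. -/
def glrSystem (L : Matrix (Fin N) (Fin N) ℝ) (S : Finset (Fin N)) (μ : ℝ) :
    Matrix (Fin N) (Fin N) ℝ :=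
  samplingProj S + (μ • samplingProj S + (1 - samplingProj S)) * L

/-- The linear reconstruction operator of GLR; for `μ = 0`, harmonic interpolation. -/
noncomputable def glrMatrix (L : Matrix (Fin N) (Fin N) ℝ) (S : Finset (Fin N)) (μ : ℝ) :
    Matrix (Fin N) (Fin N) ℝ :=
  (glrSystem L S μ)⁻¹ * samplingProj S

theorem glrSystem_mulVec (L : Matrix (Fin N) (Fin N) ℝ) (S : Finset (Fin N)) (μ : ℝ)
    (z : Fin N → ℝ) (i : Fin N) :
    (glrSystem L S μ *ᵥ z) i = if i ∈ S then z i + μ * (L *ᵥ z) i else (L *ᵥ z) i := by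
  rw [glrSystem, Matrix.add_mulVec, ← Matrix.mulVec_mulVec, Matrix.add_mulVec, Matrix.smul_mulVec,
    Matrix.sub_mulVec, Matrix.one_mulVec]
  simp only [Pi.add_apply, Pi.smul_apply, Pi.sub_apply, samplingProj_mulVec, smul_eq_mul]
  split_ifs <;> ring

section Spectral

variable {G : WeightedGraph (Fin N)} {lam : Fin N → ℝ} {U : Matrix (Fin N) (Fin N) ℝ}
  {S : Finset (Fin N)} {μ : ℝ}

theorem IsSpectralDecomposition.quadForm_nonneg {L : Matrix (Fin N) (Fin N) ℝ}
    (h : IsSpectralDecomposition L lam U) (z : Fin N → ℝ) : 0 ≤ z ⬝ᵥ L *ᵥ z := by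
  rw [h.quadForm]
  exact Finset.sum_nonneg fun l _ => mul_nonneg (h.pos l).1 (sq_nonneg _)

theorem IsSpectralDecomposition.isSymm {L : Matrix (Fin N) (Fin N) ℝ}
    (h : IsSpectralDecomposition L lam U) : L.IsSymm := by
  rw [h.eq_mul]
  simp [Matrix.IsSymm, Matrix.transpose_mul, Matrix.mul_assoc]

/-- A kernel vector `z` has `L z` supported on `S`; pairing with `z` shows that both `z` on `S` and
the Laplacian form of `z` vanish. This works for `μ = 0` too, which gives continuity of the inverse
there. -/
theorem isUnit_det_glrSystem (h : IsSpectralDecomposition G.laplacian lam U) (hS : S.Nonempty)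
    (hμ : 0 ≤ μ) : IsUnit (glrSystem G.laplacian S μ).det := by
  rw [← Matrix.isUnit_iff_isUnit_det, ← Matrix.mulVec_injective_iff_isUnit]
  change Function.Injective (Matrix.mulVecLin (glrSystem G.laplacian S μ))
  rw [injective_iff_map_eq_zero]
  intro z hz
  rw [Matrix.mulVecLin_apply] at hz
  have hrow := fun i => (glrSystem_mulVec G.laplacian S μ z i).symm.trans (congrFun hz i)
  have hq := h.quadForm_nonneg z
  have hLz : z ⬝ᵥ G.laplacian *ᵥ z = ∑ i ∈ S, z i * (G.laplacian *ᵥ z) i := by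
    rw [dotProduct, ← Finset.sum_subset (Finset.subset_univ S)]
    intro i _ hi
    have := hrow i
    rw [if_neg hi, Pi.zero_apply] at this
    rw [this, mul_zero]
  have hS2 : ∑ i ∈ S, z i ^ 2 + μ * (z ⬝ᵥ G.laplacian *ᵥ z) = 0 := by
    rw [hLz, Finset.mul_sum, ← Finset.sum_add_distrib]
    refine Finset.sum_eq_zero fun i hi => ?_
    have := hrow i
    rw [if_pos hi, Pi.zero_apply] at this
    linear_combination z i * this
  have hz0 : 0 ≤ ∑ i ∈ S, z i ^ 2 := Finset.sum_nonneg fun i _ => sq_nonneg _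
  have hz1 : ∑ i ∈ S, z i ^ 2 = 0 := by
    have := mul_nonneg hμ hq
    linarith
  have hz2 : z ⬝ᵥ G.laplacian *ᵥ z = 0 := by
    rw [hLz]
    refine Finset.sum_eq_zero fun i hi => ?_
    have := (Finset.sum_eq_zero_iff_of_nonneg fun i _ => sq_nonneg (z i)).1 hz1 i hi
    rw [pow_eq_zero_iff two_ne_zero] at this
    rw [this, zero_mul]
  by_contra hne
  have := glr_quad_pos h hS one_pos hne
  rw [hz1, hz2] at this
  simp at this

theorem glrSystem_mul_glrMatrix (h : IsSpectralDecomposition G.laplacian lam U) (hS : S.Nonempty)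
    (hμ : 0 ≤ μ) :
    glrSystem G.laplacian S μ * glrMatrix G.laplacian S μ = samplingProj S := by
  rw [glrMatrix, ← Matrix.mul_assoc, Matrix.mul_nonsing_inv _ (isUnit_det_glrSystem h hS hμ),
    Matrix.one_mul]

theorem continuousAt_glrMatrix (h : IsSpectralDecomposition G.laplacian lam U)
    (hS : S.Nonempty) : ContinuousAt (glrMatrix G.laplacian S) 0 := by
  have hc : Continuous fun μ : ℝ => glrSystem G.laplacian S μ := by
    unfold glrSystem
    fun_prop
  have hd := (isUnit_det_glrSystem (μ := 0) h hS le_rfl).ne_zero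
  have hinv : ContinuousAt (fun μ : ℝ => (glrSystem G.laplacian S μ)⁻¹) 0 := by
    simp only [Matrix.inv_def, Ring.inverse_eq_inv']
    exact (hc.matrix_det.continuousAt.inv₀ hd).smul hc.matrix_adjugate.continuousAt
  have hmul : Continuous fun X : Matrix (Fin N) (Fin N) ℝ => X * samplingProj S :=
    continuous_id.matrix_mul continuous_const
  exact hmul.continuousAt.comp hinv

theorem glrReconstruction_eq (h : IsSpectralDecomposition G.laplacian lam U) (hS : S.Nonempty)
    (hμ : 0 < μ) (w : Fin N → ℝ) :
    glrReconstruction G.laplacian μ S (fun i : S => w i) = glrMatrix G.laplacian S μ *ᵥ w := by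
  set z := glrMatrix G.laplacian S μ *ᵥ w with hz
  have hrow : ∀ i, (if i ∈ S then z i + μ * (G.laplacian *ᵥ z) i else (G.laplacian *ᵥ z) i) =
      if i ∈ S then w i else 0 := by
    intro i
    rw [← glrSystem_mulVec, hz, Matrix.mulVec_mulVec, glrSystem_mul_glrMatrix h hS hμ.le,
      samplingProj_mulVec]
  have hmin : IsMinOn (glrObjective G.laplacian μ S fun i : S => w i) Set.univ z := by
    intro z' _
    obtain ⟨d, rfl⟩ : ∃ d, z' = z + d := ⟨z' - z, by simp⟩
    have hsymm : z ⬝ᵥ G.laplacian *ᵥ d = d ⬝ᵥ G.laplacian *ᵥ z := by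
      rw [Matrix.dotProduct_mulVec, ← Matrix.mulVec_transpose, h.isSymm.eq, dotProduct_comm]
    -- The first variation vanishes by the normal equations; the second-order part is nonnegative.
    have hcross : ∑ i ∈ S, d i * (z i - w i) + μ * (d ⬝ᵥ G.laplacian *ᵥ z) = 0 := by
      have h1 : d ⬝ᵥ G.laplacian *ᵥ z = ∑ i ∈ S, d i * (G.laplacian *ᵥ z) i := by
        rw [dotProduct, ← Finset.sum_subset (Finset.subset_univ S)]
        intro i _ hi
        have := hrow i
        rw [if_neg hi, if_neg hi] at this
        rw [this, mul_zero]
      rw [h1, Finset.mul_sum, ← Finset.sum_add_distrib]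
      refine Finset.sum_eq_zero fun i hi => ?_
      have := hrow i
      rw [if_pos hi, if_pos hi] at this
      linear_combination d i * this
    have hexp : ∑ i ∈ S, ((z + d) i - w i) ^ 2 = ∑ i ∈ S, (z i - w i) ^ 2 +
        2 * ∑ i ∈ S, d i * (z i - w i) + ∑ i ∈ S, d i ^ 2 := by
      rw [Finset.mul_sum, ← Finset.sum_add_distrib, ← Finset.sum_add_distrib]
      exact Finset.sum_congr rfl fun i _ => by rw [Pi.add_apply]; ring
    change glrObjective _ _ _ _ _ ≤ glrObjective _ _ _ _ _
    rw [glrObjective, glrObjective, Finset.sum_coe_sort S fun i => (z i - w i) ^ 2,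
      Finset.sum_coe_sort S fun i => ((z + d) i - w i) ^ 2, hexp]
    simp only [Matrix.mulVec_add, dotProduct_add, add_dotProduct, hsymm]
    have h1 := mul_nonneg hμ.le (h.quadForm_nonneg d)
    have h2 : 0 ≤ ∑ i ∈ S, d i ^ 2 := Finset.sum_nonneg fun i _ => sq_nonneg _
    linarith
  exact (existsUnique_glr h hS hμ _).unique (Classical.epsilon_spec ⟨z, hmin⟩) hmin

section Harmonic

variable (h : IsSpectralDecomposition G.laplacian lam U) (hS : S.Nonempty)

theorem glrMatrix_mul_samplingProj (L : Matrix (Fin N) (Fin N) ℝ) (S : Finset (Fin N)) (μ : ℝ) :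
    glrMatrix L S μ * samplingProj S = glrMatrix L S μ := by
  rw [glrMatrix, Matrix.mul_assoc, samplingProj_mul_self]

include h hS

theorem samplingProj_mul_glrMatrix_zero :
    samplingProj S * glrMatrix G.laplacian S 0 = samplingProj S := by
  have h1 := glrSystem_mul_glrMatrix (μ := 0) h hS le_rfl
  have h2 : samplingProj S * glrSystem G.laplacian S 0 = samplingProj S := by
    rw [glrSystem, zero_smul, zero_add, Matrix.mul_add, ← Matrix.mul_assoc, Matrix.mul_sub,
      Matrix.mul_one, samplingProj_mul_self, sub_self, Matrix.zero_mul, add_zero]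
  conv_lhs => rw [← h2]
  rw [Matrix.mul_assoc, h1, samplingProj_mul_self]

theorem samplingProj_mul_laplacian_mul_glrMatrix_zero :
    samplingProj S * (G.laplacian * glrMatrix G.laplacian S 0) =
      G.laplacian * glrMatrix G.laplacian S 0 := by
  have h1 := glrSystem_mul_glrMatrix (μ := 0) h hS le_rfl
  rw [glrSystem, zero_smul, zero_add, Matrix.add_mul, samplingProj_mul_glrMatrix_zero h hS,
    Matrix.mul_assoc, Matrix.sub_mul, Matrix.one_mul] at h1
  have h2 := add_eq_left.1 h1
  exact (sub_eq_zero.1 h2).symm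

theorem glrMatrix_zero_idem :
    glrMatrix G.laplacian S 0 * glrMatrix G.laplacian S 0 = glrMatrix G.laplacian S 0 := by
  conv_lhs => rw [← glrMatrix_mul_samplingProj G.laplacian S 0]
  rw [Matrix.mul_assoc, ← Matrix.mul_assoc (samplingProj S),
    samplingProj_mul_glrMatrix_zero h hS, samplingProj_mul_self, glrMatrix_mul_samplingProj]

/-- Off `S` the interpolant is harmonic and on `S` it agrees with the data, so `Pᵀ L P = Pᵀ Π_S L P
= Π_S L P = L P`, and `Pᵀ L P` is symmetric. -/
theorem laplacian_mul_glrMatrix_zero_isSymm :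
    (G.laplacian * glrMatrix G.laplacian S 0).IsSymm := by
  have h1 : (glrMatrix G.laplacian S 0)ᵀ * (G.laplacian * glrMatrix G.laplacian S 0) =
      G.laplacian * glrMatrix G.laplacian S 0 := by
    conv_lhs => rw [← samplingProj_mul_laplacian_mul_glrMatrix_zero h hS]
    rw [← Matrix.mul_assoc]
    conv_lhs => rw [← samplingProj_transpose, ← Matrix.transpose_mul,
      samplingProj_mul_glrMatrix_zero h hS, samplingProj_transpose]
    exact samplingProj_mul_laplacian_mul_glrMatrix_zero h hS
  rw [← h1]
  simp only [Matrix.IsSymm, Matrix.transpose_mul, Matrix.transpose_transpose, h.isSymm.eq,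
    Matrix.mul_assoc]

theorem glrMatrix_zero_trace : (glrMatrix G.laplacian S 0).trace = S.card := by
  rw [← glrMatrix_mul_samplingProj, Matrix.trace_mul_comm, samplingProj_mul_glrMatrix_zero h hS,
    samplingProj_trace]

theorem glrMatrix_zero_mulVec_one : glrMatrix G.laplacian S 0 *ᵥ 1 = 1 := by
  have h1 : glrSystem G.laplacian S 0 *ᵥ 1 = samplingProj S *ᵥ 1 := by
    ext i
    rw [glrSystem_mulVec, laplacian_mulVec_one, samplingProj_mulVec]
    simp
  rw [glrMatrix, ← Matrix.mulVec_mulVec, ← h1, Matrix.mulVec_mulVec,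
    Matrix.nonsing_inv_mul _ (isUnit_det_glrSystem h hS le_rfl), Matrix.one_mulVec]

theorem one_vecMul_samplingProj_mul_glrMatrix_zero :
    (1 ᵥ* samplingProj S) ᵥ* glrMatrix G.laplacian S 0 = 1 ᵥ* samplingProj S := by
  rw [Matrix.vecMul_vecMul, samplingProj_mul_glrMatrix_zero h hS]

end Harmonic

end Spectral

/-! ### Energy of a bandlimited random vector under a linear map. -/

/-- The energy `E ‖M v‖²` of the image under `M` of a random vector `v` with covariance
`Π_bl`. -/
def energy (U : Matrix (Fin N) (Fin N) ℝ) (k : ℕ) (M : Matrix (Fin N) (Fin N) ℝ) : ℝ :=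
  ∑ i, ∑ a, ∑ b, M i a * M i b * projBL U k a b

theorem projBL_apply (U : Matrix (Fin N) (Fin N) ℝ) (k : ℕ) (a b : Fin N) :
    projBL U k a b = ∑ l : Fin N, if (l : ℕ) < k then U a l * U b l else 0 := by
  rw [projBL, Matrix.mul_apply, ← Finset.sum_filter]
  exact (Finset.sum_subtype _ (p := fun l : Fin N => (l : ℕ) < k) (by simp) fun l =>
    U a l * U b l).symm

theorem energy_eq (U : Matrix (Fin N) (Fin N) ℝ) (k : ℕ) (M : Matrix (Fin N) (Fin N) ℝ) :
    energy U k M = ∑ i, ∑ l : Fin N, if (l : ℕ) < k then (M * U) i l ^ 2 else 0 := by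
  refine Finset.sum_congr rfl fun i _ => ?_
  simp only [projBL_apply, Finset.mul_sum]
  rw [Finset.sum_congr rfl fun a _ => Finset.sum_comm, Finset.sum_comm]
  refine Finset.sum_congr rfl fun l _ => ?_
  split_ifs with hl
  · rw [Matrix.mul_apply, sq, Finset.sum_mul_sum]
    exact Finset.sum_congr rfl fun a _ => Finset.sum_congr rfl fun b _ => by ring
  · simp

theorem energy_eq_of_orthogonal {U : Matrix (Fin N) (Fin N) ℝ} (hU : Uᵀ * U = 1) (k : ℕ)
    (M : Matrix (Fin N) (Fin N) ℝ) :
    energy U k M = ∑ i, ∑ l : Fin N, if (l : ℕ) < k then (Uᵀ * M * U) i l ^ 2 else 0 := by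
  have hU' : U * Uᵀ = 1 := mul_eq_one_comm.1 hU
  rw [energy_eq, Finset.sum_comm, Finset.sum_comm (f := fun i l : Fin N =>
    if (l : ℕ) < k then (Uᵀ * M * U) i l ^ 2 else 0)]
  refine Finset.sum_congr rfl fun l _ => ?_
  split_ifs with hl
  · have h1 : ∀ X : Matrix (Fin N) (Fin N) ℝ, ∑ i, X i l ^ 2 = (Xᵀ * X) l l := by
      intro X
      rw [Matrix.mul_apply]
      exact Finset.sum_congr rfl fun i _ => by rw [Matrix.transpose_apply, sq]
    rw [h1, h1]
    rw [Matrix.mul_assoc Uᵀ, Matrix.transpose_mul Uᵀ, Matrix.transpose_transpose,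
      Matrix.mul_assoc, ← Matrix.mul_assoc U, hU', Matrix.one_mul]
  · simp

theorem continuous_energy (U : Matrix (Fin N) (Fin N) ℝ) (k : ℕ) : Continuous (energy U k) := by
  unfold energy
  fun_prop

theorem energy_one {U : Matrix (Fin N) (Fin N) ℝ} (hU : Uᵀ * U = 1) {k : ℕ} (hk : k ≤ N) :
    energy U k 1 = k := by
  rw [energy_eq_of_orthogonal hU, Matrix.mul_one, hU, Finset.sum_comm]
  have h1 : ∀ l : Fin N, (∑ i, if (l : ℕ) < k then (1 : Matrix (Fin N) (Fin N) ℝ) i l ^ 2 else 0) =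
      if (l : ℕ) < k then 1 else 0 := by
    intro l
    split_ifs
    · simp [Matrix.one_apply]
    · simp
  simp only [h1]
  rw [Finset.sum_ite, Finset.sum_const_zero, add_zero, Finset.sum_const, nsmul_one]
  have := card_fin_filter (n := N) (A := Finset.range k) (fun l hl => by simp at hl; omega)
  simp only [Finset.mem_range, Finset.card_range] at this
  rw [this]

/-- In the limit `μ → 0`, the reconstructed noise energy is at most `1 + B_k(m)`. -/
theorem energy_glrMatrix_zero_le {G : WeightedGraph (Fin N)} {lam : Fin N → ℝ}
    {U : Matrix (Fin N) (Fin N) ℝ} (h : IsSpectralDecomposition G.laplacian lam U)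
    {S : Finset (Fin N)} (hS : S.Nonempty) {k : ℕ} (hk : 2 ≤ k) (hkN : k ≤ N) :
    energy U k (glrMatrix G.laplacian S 0) ≤ 1 + boundB lam k S.card := by
  obtain ⟨n, rfl⟩ : ∃ n, N = n + 1 := ⟨N - 1, by omega⟩
  obtain ⟨K, rfl⟩ : ∃ K, k = K + 1 := ⟨k - 1, by omega⟩
  have hUU : U * Uᵀ = 1 := mul_eq_one_comm.1 h.orthogonal
  set P := glrMatrix G.laplacian S 0 with hP
  have h0 : lam 0 = 0 := by
    have := h.freq_one
    rwa [freq, dif_pos ⟨le_rfl, by omega⟩] at this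
  have hlamU : Matrix.diagonal lam * Uᵀ = Uᵀ * G.laplacian := by
    rw [h.eq_mul, ← Matrix.mul_assoc, ← Matrix.mul_assoc, h.orthogonal, Matrix.one_mul]
  -- Constants are annihilated by the Laplacian and its zero eigenvalue is simple, so `c` is
  -- supported at `0`. Hence the zeroth column of `U` is constant, with `c 0 ^ 2 = n + 1`.
  set c : Fin (n + 1) → ℝ := Uᵀ *ᵥ 1 with hc
  have hc0 : ∀ i, i ≠ 0 → c i = 0 := by
    intro i hi
    have h1 : Matrix.diagonal lam *ᵥ c = 0 := by
      rw [hc, Matrix.mulVec_mulVec, hlamU, ← Matrix.mulVec_mulVec, laplacian_mulVec_one,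
        Matrix.mulVec_zero]
    have h2 := congrFun h1 i
    rw [Matrix.mulVec_diagonal, Pi.zero_apply] at h2
    refine (mul_eq_zero.1 h2).resolve_left fun h3 => hi (Fin.ext ((h.pos i).2 h3))
  have hUc : ∀ i, U i 0 * c 0 = 1 := by
    intro i
    have h1 : U *ᵥ c = 1 := by rw [hc, Matrix.mulVec_mulVec, hUU, Matrix.one_mulVec]
    have h2 := congrFun h1 i
    rw [Matrix.mulVec, dotProduct, Fin.sum_univ_succ] at h2
    simpa [hc0] using h2
  have hU0 : ∀ i, U i 0 = (c 0)⁻¹ := fun i => eq_inv_of_mul_eq_one_left (hUc i)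
  have hcc : c 0 ^ 2 = n + 1 := by
    have h1 : c 0 = ∑ i : Fin (n + 1), U i 0 := by
      simp [hc, Matrix.mulVec, dotProduct]
    have h2 : c 0 * c 0 = (n + 1 : ℕ) := by
      conv_lhs => rw [h1, Finset.sum_mul]
      simp [← h1, hUc]
    rw [sq, h2]; push_cast; ring
  have hUone : ∀ i, U i 0 = (c 0)⁻¹ * (1 : Fin (n + 1) → ℝ) i := fun i => by simp [hU0]
  -- The indicator of `S` in spectral coordinates. Interpolation keeps the samples, so it preserves
  -- their sum, which makes `v` a left fixed vector.
  set v : Fin (n + 1) → ℝ := (1 ᵥ* samplingProj S) ᵥ* U with hv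
  have h1S : ∀ i, (1 ᵥ* samplingProj S) i = if i ∈ S then (1 : ℝ) else 0 := by
    intro i
    simp [samplingProj, Matrix.vecMul_diagonal]
  rw [energy_eq_of_orthogonal h.orthogonal]
  refine sum_sq_spectral_le (v := v) h.strictMono h0 ?_ ?_ ?_ (Finset.card_pos.2 hS)
    ?_ ?_ ?_ ?_ (by omega) (by omega)
  · have hs : (Matrix.diagonal lam * (Uᵀ * P * U)).IsSymm := by
      have : Matrix.diagonal lam * (Uᵀ * P * U) = Uᵀ * (G.laplacian * P) * U := by
        rw [← Matrix.mul_assoc, ← Matrix.mul_assoc, hlamU]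
        simp only [Matrix.mul_assoc]
      rw [this]
      simp only [Matrix.IsSymm, Matrix.transpose_mul, Matrix.transpose_transpose]
      rw [← Matrix.transpose_mul, (laplacian_mul_glrMatrix_zero_isSymm h hS).eq, ← Matrix.mul_assoc]
    intro i j
    have := hs.apply j i
    rwa [Matrix.diagonal_mul, Matrix.diagonal_mul] at this
  · have : Uᵀ * P * U * (Uᵀ * P * U) = Uᵀ * (P * (U * Uᵀ) * P) * U := by
      simp only [Matrix.mul_assoc]
    rw [this, hUU, Matrix.mul_one, glrMatrix_zero_idem h hS]
  · intro i
    have h1 : ∀ j, (P * U) j 0 = U j 0 := by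
      intro j
      have h2 := congrFun (glrMatrix_zero_mulVec_one h hS) j
      rw [Matrix.mul_apply, hUone j, ← h2]
      simp only [hU0]
      rw [← Finset.sum_mul, mul_comm]
      simp [Matrix.mulVec, dotProduct, hP]
    rw [Matrix.mul_assoc, Matrix.mul_apply]
    simp only [h1]
    rw [← Matrix.mul_apply, h.orthogonal, Matrix.one_apply]
  · rw [Matrix.trace_mul_comm, ← Matrix.mul_assoc, hUU, Matrix.one_mul,
      glrMatrix_zero_trace h hS]
  · rw [hv, Matrix.vecMul_vecMul, ← Matrix.mul_assoc, ← Matrix.mul_assoc, hUU, Matrix.one_mul,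
      ← Matrix.vecMul_vecMul, one_vecMul_samplingProj_mul_glrMatrix_zero h hS]
  · have : v 0 = S.card * (c 0)⁻¹ := by
      rw [hv, Matrix.vecMul, dotProduct]
      simp only [h1S, hU0]
      simp
    rw [this, mul_pow, inv_pow, hcc]
    rfl
  · have : ∑ i, v i ^ 2 = v ⬝ᵥ v := by simp [dotProduct, sq]
    rw [this]
    conv_lhs => rw [hv]
    rw [← Matrix.dotProduct_mulVec, ← Matrix.mulVec_transpose U, Matrix.mulVec_mulVec, hUU,
      Matrix.one_mulVec]
    simp [dotProduct, h1S]

/-! ### Second moments, the SNR and the bias-variance decomposition. -/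

section Moments

variable {Ω : Type*} [MeasurableSpace Ω] {P : Measure Ω}

theorem mulVec_apply_mul_mulVec_apply (A B : Matrix (Fin N) (Fin N) ℝ) (u w : Fin N → ℝ)
    (i : Fin N) :
    (A *ᵥ u) i * (B *ᵥ w) i = ∑ a, ∑ b, A i a * B i b * (u a * w b) := by
  rw [Matrix.mulVec, Matrix.mulVec, dotProduct, dotProduct, Finset.sum_mul_sum]
  exact Finset.sum_congr rfl fun a _ => Finset.sum_congr rfl fun b _ => by ring

theorem integrable_sum_mulVec_mul_mulVec {X Y : Ω → Fin N → ℝ}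
    (hint : ∀ a b, Integrable (fun ω => X ω a * Y ω b) P) (A B : Matrix (Fin N) (Fin N) ℝ) :
    Integrable (fun ω => ∑ i, (A *ᵥ X ω) i * (B *ᵥ Y ω) i) P := by
  simp only [mulVec_apply_mul_mulVec_apply]
  exact integrable_finsetSum _ fun i _ => integrable_finsetSum _ fun a _ =>
    integrable_finsetSum _ fun b _ => (hint a b).const_mul _

theorem integral_sum_mulVec_mul_mulVec {X Y : Ω → Fin N → ℝ}
    (hint : ∀ a b, Integrable (fun ω => X ω a * Y ω b) P) (A B : Matrix (Fin N) (Fin N) ℝ) :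
    ∫ ω, ∑ i, (A *ᵥ X ω) i * (B *ᵥ Y ω) i ∂P =
      ∑ i, ∑ a, ∑ b, A i a * B i b * ∫ ω, X ω a * Y ω b ∂P := by
  have hi : ∀ i a b, Integrable (fun ω => A i a * B i b * (X ω a * Y ω b)) P :=
    fun i a b => (hint a b).const_mul _
  simp only [mulVec_apply_mul_mulVec_apply]
  rw [integral_finsetSum _ fun i _ => integrable_finsetSum _ fun a _ =>
    integrable_finsetSum _ fun b _ => hi i a b]
  refine Finset.sum_congr rfl fun i _ => ?_
  rw [integral_finsetSum _ fun a _ => integrable_finsetSum _ fun b _ => hi i a b]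
  refine Finset.sum_congr rfl fun a _ => ?_
  rw [integral_finsetSum _ fun b _ => hi i a b]
  exact Finset.sum_congr rfl fun b _ => integral_const_mul _ _

variable {U : Matrix (Fin N) (Fin N) ℝ} {k : ℕ} {x ε : Ω → Fin N → ℝ}

namespace IsBandlimitedModel

variable (hM : IsBandlimitedModel P U k x ε)

include hM

theorem integral_signal_mul_noise (a b : Fin N) : ∫ ω, x ω a * ε ω b ∂P = 0 := by
  have h := hM.indep.comp (measurable_pi_apply a) (measurable_pi_apply b)
  have h2 := h.integral_fun_mul_eq_mul_integral (hM.memLp_signal a).1 (hM.memLp_noise b).1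
  simp only [Function.comp_apply, hM.mean_signal, zero_mul] at h2
  exact h2

variable [IsProbabilityMeasure P]

theorem integral_signal_mul_signal (a b : Fin N) : ∫ ω, x ω a * x ω b ∂P = projBL U k a b := by
  have h := hM.cov_signal a b
  rw [covariance_eq_sub (hM.memLp_signal a) (hM.memLp_signal b), hM.mean_signal, zero_mul,
    sub_zero] at h
  exact h

theorem integral_noise_mul_noise (a b : Fin N) : ∫ ω, ε ω a * ε ω b ∂P = projBL U k a b := by
  have h := hM.cov_noise a b
  rw [covariance_eq_sub (hM.memLp_noise a) (hM.memLp_noise b), hM.mean_noise, zero_mul,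
    sub_zero] at h
  exact h

theorem integral_sqNorm_signal : ∫ ω, sqNorm (x ω) ∂P = energy U k 1 := by
  have h := integral_sum_mulVec_mul_mulVec
    (fun a b => (hM.memLp_signal a).integrable_mul (hM.memLp_signal b)) 1 1
  simp only [Matrix.one_mulVec, hM.integral_signal_mul_signal, ← sq] at h
  exact h

theorem integral_sqNorm_noise (σ : ℝ) :
    ∫ ω, sqNorm (σ • ε ω) ∂P = σ ^ 2 * energy U k 1 := by
  have h := integral_sum_mulVec_mul_mulVec
    (fun a b => (hM.memLp_noise a).integrable_mul (hM.memLp_noise b)) 1 1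
  simp only [Matrix.one_mulVec, hM.integral_noise_mul_noise, ← sq] at h
  rw [energy, ← h, ← integral_const_mul]
  simp only [sqNorm, Pi.smul_apply, smul_eq_mul, mul_pow, Finset.mul_sum]

theorem snr_eq (hU : Uᵀ * U = 1) (hk : 1 ≤ k) (hkN : k ≤ N) (σ : ℝ) :
    snr P x (fun ω => σ • ε ω) = 1 / σ ^ 2 := by
  have hk0 : (k : ℝ) ≠ 0 := by positivity
  rw [snr, hM.integral_sqNorm_signal, hM.integral_sqNorm_noise, energy_one hU hkN,
    div_mul_cancel_right₀ hk0, one_div]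

/-- Bias-variance decomposition of the mean squared error. -/
theorem mse_eq {G : WeightedGraph (Fin N)} {lam : Fin N → ℝ}
    (h : IsSpectralDecomposition G.laplacian lam U) {S : Finset (Fin N)} (hS : S.Nonempty)
    {μ : ℝ} (hμ : 0 < μ) (σ : ℝ) :
    mse P G.laplacian μ x (fun ω => σ • ε ω) S =
      energy U k (glrMatrix G.laplacian S μ - 1) +
        σ ^ 2 * energy U k (glrMatrix G.laplacian S μ) := by
  set R := glrMatrix G.laplacian S μ with hR
  have hxx : ∀ a b, Integrable (fun ω => x ω a * x ω b) P :=
    fun a b => (hM.memLp_signal a).integrable_mul (hM.memLp_signal b)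
  have hxe : ∀ a b, Integrable (fun ω => x ω a * ε ω b) P :=
    fun a b => (hM.memLp_signal a).integrable_mul (hM.memLp_noise b)
  have hee : ∀ a b, Integrable (fun ω => ε ω a * ε ω b) P :=
    fun a b => (hM.memLp_noise a).integrable_mul (hM.memLp_noise b)
  have hpt : ∀ ω, sqNorm (glrReconstruction G.laplacian μ S
      (fun i : S => (x ω + σ • ε ω) i) - x ω) =
      ∑ i, ((R - 1) *ᵥ x ω) i * ((R - 1) *ᵥ x ω) i +
        (2 * σ) * ∑ i, ((R - 1) *ᵥ x ω) i * (R *ᵥ ε ω) i +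
        σ ^ 2 * ∑ i, (R *ᵥ ε ω) i * (R *ᵥ ε ω) i := by
    intro ω
    rw [glrReconstruction_eq h hS hμ, ← hR, sqNorm, Finset.mul_sum, Finset.mul_sum,
      ← Finset.sum_add_distrib, ← Finset.sum_add_distrib]
    refine Finset.sum_congr rfl fun i _ => ?_
    rw [Matrix.mulVec_add, Matrix.mulVec_smul, Matrix.sub_mulVec, Matrix.one_mulVec]
    simp only [Pi.sub_apply, Pi.add_apply, Pi.smul_apply, smul_eq_mul]
    ring
  have i1 := integrable_sum_mulVec_mul_mulVec hxx (R - 1) (R - 1)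
  have i2 := (integrable_sum_mulVec_mul_mulVec hxe (R - 1) R).const_mul (2 * σ)
  have i3 := (integrable_sum_mulVec_mul_mulVec hee R R).const_mul (σ ^ 2)
  have i12 : Integrable (fun ω => ∑ i, ((R - 1) *ᵥ x ω) i * ((R - 1) *ᵥ x ω) i +
      2 * σ * ∑ i, ((R - 1) *ᵥ x ω) i * (R *ᵥ ε ω) i) P := i1.add i2
  rw [mse]
  simp only [hpt]
  rw [integral_add i12 i3, integral_add i1 i2, integral_const_mul, integral_const_mul,
    integral_sum_mulVec_mul_mulVec hxx, integral_sum_mulVec_mul_mulVec hxe,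
    integral_sum_mulVec_mul_mulVec hee]
  simp only [hM.integral_signal_mul_signal, hM.integral_signal_mul_noise,
    hM.integral_noise_mul_noise]
  simp [energy]

end IsBandlimitedModel

end Moments

/-! ### The size of the optimal sample. -/

theorem freq_pos {lam : Fin N → ℝ} (hlam : StrictMono lam) (h1 : freq lam 1 = 0) {i : ℕ}
    (hi : 2 ≤ i) (hiN : i ≤ N) : 0 < freq lam i := by
  rw [freq, dif_pos ⟨le_rfl, by omega⟩] at h1
  rw [freq, dif_pos ⟨by omega, hiN⟩, ← h1]
  exact hlam (Fin.mk_lt_mk.2 (by omega))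

theorem freq_le_freq {lam : Fin N → ℝ} (hlam : StrictMono lam) (h1 : freq lam 1 = 0) {i j : ℕ}
    (hij : i ≤ j) (hj : 1 ≤ j) (hjN : j ≤ N) : freq lam i ≤ freq lam j := by
  have hmono : ∀ i, 1 ≤ i → i ≤ j → freq lam i ≤ freq lam j := fun i hi hij => by
    rw [freq, dif_pos ⟨hi, by omega⟩, freq, dif_pos ⟨hj, hjN⟩]
    exact hlam.monotone (Fin.mk_le_mk.2 (by omega))
  rcases Nat.eq_zero_or_pos i with rfl | hi
  · have h0 : freq lam 0 = 0 := dif_neg (by omega)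
    rw [h0, ← h1]
    exact hmono 1 le_rfl hj
  · exact hmono i hi hij

theorem kantorovich_nonneg (x : ℝ) : 0 ≤ kantorovich x := by
  unfold kantorovich
  positivity

theorem two_le_of_boundB_lt {lam : Fin N → ℝ} {k m : ℕ} (hB : boundB lam k m < (k : ℝ) - 1) :
    2 ≤ k := by
  have h0 : 0 ≤ boundB lam k m := by
    refine add_nonneg (mul_nonneg (kantorovich_nonneg _) (by positivity))
      (Finset.sum_nonneg fun i _ => kantorovich_nonneg _)
  have h1 : (1 : ℝ) < k := by linarith
  exact_mod_cast h1

/-- Past the midpoint the last summand of `B_k` is `1`, so with `m = p + 1` minimality gives `p (p +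
1) ≤ ρ N`. The hypothesis gives `ρ N < (k - 1 - p) (p + 1)`. Together `2 p + 1 < k ≤ N`, a
contradiction. -/
theorem IsOptimalSize.two_mul_le {lam : Fin N → ℝ} (hlam : StrictMono lam)
    (h1 : freq lam 1 = 0) {k m : ℕ} (hkN : k ≤ N) (hm : IsOptimalSize lam k m)
    (hB : boundB lam k m < (k : ℝ) - 1) : 2 * m ≤ N + 2 := by
  by_contra! hcon
  obtain ⟨⟨hm1, hmN⟩, hmin⟩ := hm
  obtain ⟨p, rfl⟩ : ∃ p, m = p + 1 := ⟨m - 1, by omega⟩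
  have hp0 : (0 : ℝ) < p := by exact_mod_cast (by omega : 0 < p)
  have hle : boundB lam k (p + 1) ≤ boundB lam k p :=
    isMinOn_iff.1 hmin p ⟨by omega, by omega⟩
  set ρ := kantorovich (freq lam k / freq lam 2) with hρ
  have hsum : ∑ i ∈ Finset.Icc 2 (p + 1), kantorovich (max 1 (freq lam (k + 2 - i) / freq lam i)) =
      ∑ i ∈ Finset.Icc 2 p, kantorovich (max 1 (freq lam (k + 2 - i) / freq lam i)) + 1 := by
    rw [Finset.sum_Icc_succ_top (by omega)]
    have hpos := freq_pos hlam h1 (i := p + 1) (by omega) hmN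
    have hfr : freq lam (k + 2 - (p + 1)) ≤ freq lam (p + 1) :=
      freq_le_freq hlam h1 (by omega) hm1 hmN
    rw [max_eq_left ((div_le_one hpos).2 hfr), kantorovich_one]
  have hge : (p : ℝ) ≤
      ∑ i ∈ Finset.Icc 2 (p + 1), kantorovich (max 1 (freq lam (k + 2 - i) / freq lam i)) := by
    have : ∑ i ∈ Finset.Icc 2 (p + 1), (1 : ℝ) = p := by simp
    rw [← this]
    exact Finset.sum_le_sum fun i _ => one_le_kantorovich (lt_max_of_lt_left one_pos)
  have hstep : (p : ℝ) * (p + 1) ≤ ρ * N := by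
    rw [boundB, boundB, hsum, ← hρ] at hle
    push_cast at hle
    have h2 : ρ * (N / (p : ℝ)) - ρ * (N / (p + 1)) = ρ * N / (p * (p + 1)) := by
      field_simp
      ring
    have h3 : 1 ≤ ρ * N / (p * (p + 1)) := by linarith
    rwa [one_le_div (by positivity)] at h3
  have hlt : ρ * N < (k - 1 - p) * (p + 1) := by
    rw [boundB, ← hρ] at hB
    push_cast at hB
    have : ρ * (N / (p + 1 : ℝ)) < k - 1 - p := by linarith
    rwa [← mul_div_assoc, div_lt_iff₀ (by positivity)] at this
  have h4 : (p : ℝ) < k - 1 - p := lt_of_mul_lt_mul_right (hstep.trans_lt hlt) (by positivity)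
  have h5 : (2 * p + 1 : ℝ) < k := by linarith
  have h6 : 2 * p + 1 < k := by exact_mod_cast h5
  omega

/-! ### Thresholds for `μ` and the SNR. -/

theorem glrMatrix_univ_zero {G : WeightedGraph (Fin N)} {lam : Fin N → ℝ}
    {U : Matrix (Fin N) (Fin N) ℝ} (h : IsSpectralDecomposition G.laplacian lam U)
    (hN : (Finset.univ : Finset (Fin N)).Nonempty) :
    glrMatrix G.laplacian Finset.univ 0 = 1 := by
  have h1 : samplingProj (Finset.univ : Finset (Fin N)) = 1 := by simp [samplingProj]
  have h2 := samplingProj_mul_glrMatrix_zero h hN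
  rwa [h1, Matrix.one_mul] at h2

theorem exists_forall_energy_lt {G : WeightedGraph (Fin N)} {lam : Fin N → ℝ}
    {U : Matrix (Fin N) (Fin N) ℝ} (h : IsSpectralDecomposition G.laplacian lam U)
    {k m : ℕ} (hk : 2 ≤ k) (hkN : k ≤ N) (hm : 1 ≤ m) (hB : boundB lam k m < (k : ℝ) - 1) :
    ∃ δ : ℝ, 0 < δ ∧ ∀ μ : ℝ, 0 < μ → μ < δ → ∀ S : Finset (Fin N), S.card = m →
      energy U k (glrMatrix G.laplacian S μ) <
        energy U k (glrMatrix G.laplacian Finset.univ μ) := by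
  have hN : (Finset.univ : Finset (Fin N)).Nonempty := ⟨⟨0, by omega⟩, Finset.mem_univ _⟩
  have hev : ∀ᶠ μ in nhds (0 : ℝ), ∀ S : Finset (Fin N), S.card = m →
      energy U k (glrMatrix G.laplacian S μ) <
        energy U k (glrMatrix G.laplacian Finset.univ μ) := by
    rw [Filter.eventually_all]
    intro S
    rw [Filter.eventually_imp_distrib_left]
    intro hS
    have hSne : S.Nonempty := Finset.card_pos.1 (by omega)
    have hc : ∀ T : Finset (Fin N), T.Nonempty →
        ContinuousAt (fun μ => energy U k (glrMatrix G.laplacian T μ)) 0 := fun T hT =>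
      (continuous_energy U k).continuousAt.comp (continuousAt_glrMatrix h hT)
    refine (hc S hSne).eventually_lt (hc _ hN) ?_
    rw [glrMatrix_univ_zero h hN, energy_one h.orthogonal hkN]
    have := energy_glrMatrix_zero_le h hSne hk hkN
    rw [hS] at this
    linarith
  obtain ⟨δ, hδ, hball⟩ := Metric.eventually_nhds_iff.1 hev
  refine ⟨δ, hδ, fun μ hμ hμδ => hball ?_⟩
  rwa [Real.dist_eq, sub_zero, abs_of_pos hμ]

theorem exists_pos_forall_mul_lt {ι : Type*} [Finite ι] {p : ι → Prop} {b g : ι → ℝ}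
    (hg : ∀ i, p i → 0 < g i) :
    ∃ τ : ℝ, 0 < τ ∧ ∀ i, p i → τ * b i < g i := by
  have hev : ∀ᶠ τ in nhds (0 : ℝ), ∀ i, p i → τ * b i < g i := by
    rw [Filter.eventually_all]
    intro i
    rw [Filter.eventually_imp_distrib_left]
    intro hi
    have hc : ContinuousAt (fun τ : ℝ => τ * b i) 0 := by fun_prop
    exact hc.eventually_lt continuousAt_const (by simpa using hg i hi)
  obtain ⟨δ, hδ, hball⟩ := Metric.eventually_nhds_iff.1 hev
  refine ⟨δ / 2, by linarith, hball ?_⟩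
  rw [Real.dist_eq, sub_zero, abs_of_pos (by linarith)]
  linarith

end GraphSampling

theorem theorem5 (N : ℕ) (G : GraphSampling.WeightedGraph (Fin N))
    (hconn : G.graph.Connected)
    (lam : Fin N → ℝ) (U : Matrix (Fin N) (Fin N) ℝ)
    (hspec : GraphSampling.IsSpectralDecomposition G.laplacian lam U)
    (k : ℕ) (hk : 1 ≤ k) (hkN : k ≤ N)
    (m : ℕ) (hm : GraphSampling.IsOptimalSize lam k m)
    (hB : GraphSampling.boundB lam k m < (k : ℝ) - 1) :
    m ≤ ⌈((N : ℝ) + 1) / 2⌉₊ ∧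
    ∃ μ_ub : ℝ, 0 < μ_ub ∧ ∀ μ : ℝ, 0 < μ → μ < μ_ub →
      ∃ τ : ℝ, 0 < τ ∧
        ∀ (Ω : Type u) [MeasurableSpace Ω] (P : MeasureTheory.Measure Ω)
          [MeasureTheory.IsProbabilityMeasure P] (x ε : Ω → Fin N → ℝ) (σ : ℝ),
          GraphSampling.IsBandlimitedModel P U k x ε → 0 < σ →
          GraphSampling.snr P x (fun ω => σ • ε ω) < τ →
          ∀ S : Finset (Fin N), S.card = m →
            GraphSampling.mse P G.laplacian μ x (fun ω => σ • ε ω) S <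
              GraphSampling.mse P G.laplacian μ x (fun ω => σ • ε ω) Finset.univ := by
  have hN : (Finset.univ : Finset (Fin N)).Nonempty := ⟨⟨0, by omega⟩, Finset.mem_univ _⟩
  have hm1 : 1 ≤ m := hm.1.1
  constructor
  · have h1 := hm.two_mul_le hspec.strictMono hspec.freq_one hkN hB
    have h2 : (2 * m : ℝ) ≤ N + 2 := by exact_mod_cast h1
    have h3 := Nat.le_ceil (((N : ℝ) + 1) / 2)
    have h4 : (2 * m : ℝ) ≤ 2 * ⌈((N : ℝ) + 1) / 2⌉₊ + 1 := by linarith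
    have h5 : 2 * m ≤ 2 * ⌈((N : ℝ) + 1) / 2⌉₊ + 1 := by exact_mod_cast h4
    -- Parity closes the gap: `2 * m` is even and the bound is odd.
    omega
  obtain ⟨δ, hδ, hgap⟩ := GraphSampling.exists_forall_energy_lt hspec
    (GraphSampling.two_le_of_boundB_lt hB) hkN hm1 hB
  refine ⟨δ, hδ, fun μ hμ hμδ => ?_⟩
  obtain ⟨τ, hτ, hτS⟩ := GraphSampling.exists_pos_forall_mul_lt
    (p := fun S : Finset (Fin N) => S.card = m)
    (b := fun S => GraphSampling.energy U k (GraphSampling.glrMatrix G.laplacian S μ - 1) -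
      GraphSampling.energy U k (GraphSampling.glrMatrix G.laplacian Finset.univ μ - 1))
    fun S hS => sub_pos.2 (hgap μ hμ hμδ S hS)
  refine ⟨τ, hτ, fun Ω _ P _ x ε σ hM hσ hsnr S hS => ?_⟩
  have hSne : S.Nonempty := Finset.card_pos.1 (by omega)
  rw [hM.snr_eq hspec.orthogonal hk hkN, div_lt_iff₀ (by positivity)] at hsnr
  rw [hM.mse_eq hspec hSne hμ, hM.mse_eq hspec hN hμ]
  have h1 := hτS S hS
  have h2 := sub_pos.2 (hgap μ hμ hμδ S hS)
  set b := GraphSampling.energy U k (GraphSampling.glrMatrix G.laplacian S μ - 1) -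
    GraphSampling.energy U k (GraphSampling.glrMatrix G.laplacian Finset.univ μ - 1) with hb
  set g := GraphSampling.energy U k (GraphSampling.glrMatrix G.laplacian Finset.univ μ) -
    GraphSampling.energy U k (GraphSampling.glrMatrix G.laplacian S μ) with hg
  have hσ2 : 0 < σ ^ 2 := by positivity
  -- `b` is the extra bias of `S` and `g` its gain in noise energy. If `b > 0`, then `1 < τ * σ ^ 2`
  -- and `τ * b < g` give `b < σ ^ 2 * (τ * b) < σ ^ 2 * g`.
  have h3 : b < σ ^ 2 * g := by
    rcases le_or_gt b 0 with hb0 | hb0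
    · exact hb0.trans_lt (mul_pos hσ2 h2)
    · have h4 := mul_lt_mul_of_pos_left h1 hσ2
      have h5 := mul_lt_mul_of_pos_right hsnr hb0
      linarith
  rw [hb, hg, mul_sub] at h3
  linarith
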